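/- **Tensor products.** Let $A,B,C$ be unital $C^*$-algebras and let $\lambda:A\to C$, $\rho:B\to C$ be unital $*$-homomorphisms with commuting ranges such that the elements $a\otimes b:=\lambda(a)\rho(b)$ span a dense subspace of $C$. (Examples: $C=A\otimes B$ the spatial tensor product with $\lambda(a)=a\otimes 1$, $\rho(b)=1\otimes b$; or $A=B=C$ commutative with $\lambda=\rho=\mathrm{id}$, where $a\otimes b=ab$.) Let $M_1$ be a (left) Hilbert $A$-module and $M_2$ a (left) Hilbert $B$-module, with inner products linear in the first variable. Let $M_1\otimes M_2$ be the Hilbert $C$-module obtained from the algebraic tensor product over $\mathbb C$ by separation and completion with respect to $\langle x\otimes y,x'\otimes y'\rangle=\langle x,x'\rangle\otimes\langle y,y'\rangle$, with $(a\otimes b)(x\otimes y)=ax\otimes by$. (In the two examples this is the exterior tensor product, respectively the tensor product $M_1\otimes_A M_2$ with $\langle x\otimes y,x'\otimes y'\rangle=\langle x,x'\rangle\langle y,y'\rangle$.) For bounded operators $T_1$ on $M_1$ and $T_2$ on $M_2$, $T_1\otimes T_2$ denotes the bounded operator on $M_1\otimes M_2$ with $(T_1\otimes T_2)(f\otimes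 g)=T_1f\otimes T_2g$, when it exists. **Bessel mappings and multipliers.** Let $(\Omega,\mu)$ be a measure space, $E$ a Hilbert $D$-module, $S\subseteq E$, and $X,Y:\Omega\to E$. Take $S=E$ for $E=M_1,M_2$, and take $S$ to be the set of pure tensors $f\otimes g$ for $E=M_1\otimes M_2$. The pair $(X,Y)$ is a *continuous biframe Bessel mapping* if for all $f\in S$ the maps $\langle f,X(\cdot)\rangle$, $\langle f,Y(\cdot)\rangle$ are (strongly) measurable and $\langle f,X(\cdot)\rangle\langle Y(\cdot),f\rangle$ is integrable, and if there is $K>0$ with $$\int_\Omega\langle f,X(\omega)\rangle\langle Y(\omega),f\rangle\,d\mu(\omega)\le K\langle f,f\rangle\qquad(f\in S)$$ in the order of $D$. Let $m:\Omega\to\mathbb C$. A bounded linear operator $T$ on $E$ is the *Bessel multiplier* $M_{m,X,Y}$ if for all $f\in S$ $$Tf=\int_\Omega m(\omega)\langle f,X(\omega)\rangle Y(\omega)\,d\mu(\omega)$$ as a Bochner integral (of an integrable function), and it is the multiplier *in the weak sense* if for all $f,g\in S$ the following integrand is integrable and $$\langle Tf,g\rangle=\int_\Omega m(\omega)\langle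 f,X(\omega)\rangle\langle Y(\omega),g\rangle\,d\mu(\omega).$$ **Proposition.** Let $(\Omega_1,\mu_1)$ and $(\Omega_2,\mu_2)$ be s-finite measure spaces, let $(X_i,Y_i)$ be a continuous biframe Bessel mapping on $M_i$ with respect to $(\Omega_i,\mu_i)$, and let $m_i:\Omega_i\to\mathbb C$ be measurable ($i=1,2$). On $\Omega_1\times\Omega_2$ with the measure $\mu_1\otimes\mu_2$ put $$X(\omega_1,\omega_2)=X_1(\omega_1)\otimes X_2(\omega_2),\quad Y(\omega_1,\omega_2)=Y_1(\omega_1)\otimes Y_2(\omega_2),\quad m(\omega_1,\omega_2)=m_1(\omega_1)m_2(\omega_2).$$ Then: 1. $(X,Y)$ is a continuous biframe Bessel mapping on $M_1\otimes M_2$. 2. If the multipliers $T_1=M_{m_1,X_1,Y_1}$ and $T_2=M_{m_2,X_2,Y_2}$ exist as bounded operators (both as Bochner integrals, or both in the weak sense), then the bounded operator $T_1\otimes T_2$ exists, it is adjointable if $T_1$ and $T_2$ are, and $M_{m,X,Y}$ exists in the same sense, is unique, and $$M_{m,X,Y}=M_{m_1,X_1,Y_1}\otimes M_{m_2,X_2,Y_2}.$$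 -/

import Mathlib

open scoped TensorProduct

namespace BesselTensor

set_option linter.unusedSectionVars false

section Gram

theorem exists_factor_or_witness {D : Type*} [CStarAlgebra D] (M : D) (hM : star M = M) :
    ∃ N Y : D, star N * M * N = -(star Y * Y) ∧ (Y = 0 → ∃ Z : D, M = star Z * Z) := by
  let _ : PartialOrder D := CStarAlgebra.spectralOrder D
  have _ : StarOrderedRing D := CStarAlgebra.spectralOrderedRing D
  have hM' : IsSelfAdjoint M := hM
  have hN0 : 0 ≤ M⁻ := CFC.negPart_nonneg M
  have hNs : star M⁻ = M⁻ := (IsSelfAdjoint.of_nonneg hN0).star_eq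
  have key : star M⁻ * M * M⁻ = -(star M⁻ * M⁻ * M⁻) := by
    have e := congrArg (M⁻ * ·) (CFC.posPart_sub_negPart M hM')
    simp only [mul_sub, CFC.negPart_mul_posPart, zero_sub] at e
    rw [hNs, ← e, neg_mul]
  have hpos : 0 ≤ star M⁻ * M⁻ * M⁻ := star_left_conjugate_nonneg hN0 _
  obtain ⟨Y, hY⟩ := CStarAlgebra.nonneg_iff_eq_star_mul_self.mp hpos
  refine ⟨M⁻, Y, by rw [key, hY], fun hY0 => ?_⟩
  have hcube : M⁻ * M⁻ * M⁻ = 0 := by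
    rw [hNs] at hY; rw [hY, hY0]; simp
  have h4 : star (M⁻ * M⁻) * (M⁻ * M⁻) = 0 := by
    rw [star_mul, hNs, ← mul_assoc, hcube, zero_mul]
  have h5 : star M⁻ * M⁻ = 0 := by
    rw [hNs]; exact CStarRing.star_mul_self_eq_zero_iff _ |>.mp h4
  have h6 : M⁻ = 0 := CStarRing.star_mul_self_eq_zero_iff _ |>.mp h5
  exact CStarAlgebra.nonneg_iff_eq_star_mul_self.mp ((CFC.negPart_eq_zero_iff M hM').mp h6)

variable {A : Type*} [CStarAlgebra A] [PartialOrder A] [StarOrderedRing A]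

theorem cstarMatrix_exists_factor {n : ℕ} (M : CStarMatrix (Fin n) (Fin n) A) (hM : star M = M)
    (h : ∀ v : Fin n → A, 0 ≤ ∑ k, ∑ l, star (v k) * M k l * v l) :
    ∃ Z : CStarMatrix (Fin n) (Fin n) A, M = star Z * Z := by
  obtain ⟨N, Y, hNY, hZ⟩ := exists_factor_or_witness M hM
  refine hZ ?_
  have hdiag : ∀ k, ∑ r, star (Y r k) * Y r k = 0 := by
    intro k
    apply le_antisymm
    · have h1 := h (fun l => N l k)
      have h2 : ∑ a, ∑ b, star (N a k) * M a b * N b k = (star N * M * N) k k := by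
        rw [CStarMatrix.mul_apply, Finset.sum_comm]
        refine Finset.sum_congr rfl fun b _ => ?_
        rw [CStarMatrix.mul_apply, Finset.sum_mul]
        rfl
      rw [h2, hNY, CStarMatrix.neg_apply, CStarMatrix.mul_apply] at h1
      exact neg_nonneg.mp h1
    · exact Finset.sum_nonneg fun r _ => star_mul_self_nonneg (Y r k)
  ext r k
  have h2 := (Finset.sum_eq_zero_iff_of_nonneg
    (fun r _ => star_mul_self_nonneg (Y r k))).mp (hdiag k) r (Finset.mem_univ r)
  exact CStarRing.star_mul_self_eq_zero_iff _ |>.mp h2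

variable {M : Type*} [NormedAddCommGroup M] [NormedSpace ℂ M] [Module A M] [CStarModule A M]

/-- The Gram matrix of finitely many vectors of a Hilbert module is of the form `star Y * Y`. -/
theorem exists_gram_factor {n : ℕ} (x : Fin n → M) :
    ∃ Y : Fin n → Fin n → A, ∀ k l, inner A (x k) (x l) = ∑ r, star (Y r l) * Y r k := by
  obtain ⟨Y, hY⟩ := cstarMatrix_exists_factor
    (CStarMatrix.ofMatrix fun l k => inner A (x k) (x l)) (by
      ext k l
      exact CStarModule.star_inner _ _) (fun v => by
      have h := CStarModule.inner_self_nonneg (A := A) (x := ∑ k, star (v k) • x k)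
      simp only [CStarModule.inner_sum_right, CStarModule.inner_sum_left,
        CStarModule.inner_op_smul_right, CStarModule.inner_op_smul_left, star_star] at h
      simp only [Finset.mul_sum, ← mul_assoc] at h
      exact h)
  refine ⟨fun r k => Y r k, fun k l => ?_⟩
  have := congrFun (congrFun hY l) k
  rw [CStarMatrix.mul_apply] at this
  exact this

theorem ext_inner {x y : M} (h : ∀ w : M, (inner A w x : A) = inner A w y) : x = y := by
  rw [← sub_eq_zero, ← CStarModule.inner_self (A := A), CStarModule.inner_sub_right, h, sub_self]

/-- Multiplication by an algebra element as a `ℂ`-linear map. -/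
def lsmul (a : A) : M →ₗ[ℂ] M where
  toFun x := a • x
  map_add' x y := smul_add a x y
  map_smul' z x := ext_inner (A := A) fun w => by simp

end Gram


section Completion

open UniformSpace

section

variable {V C : Type*} [SeminormedAddCommGroup V] [NormedSpace ℂ V]
  [NormedAddCommGroup C] [NormedSpace ℂ C] [CompleteSpace C] (F : V →L⋆[ℂ] V →L[ℂ] C)

/-- The extension by continuity of a continuous sesquilinear form to the completion. -/
noncomputable def complForm (z w : Completion V) : C :=
  ((Completion.isDenseInducing_toCompl V).prodMap (Completion.isDenseInducing_toCompl V)).extend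
    (fun p : V × V => F p.1 p.2) (z, w)

theorem complForm_coe (z w : V) : complForm F (z : Completion V) (w : Completion V) = F z w :=
  ((Completion.isDenseInducing_toCompl V).prodMap
    (Completion.isDenseInducing_toCompl V)).extend_eq
      (f := fun p : V × V => F p.1 p.2) (by fun_prop) (z, w)

theorem continuous_complForm :
    Continuous fun p : Completion V × Completion V => complForm F p.1 p.2 := by
  let F' : V →+ V →+ C :=
    { toFun := fun z => (F z).toLinearMap.toAddMonoidHom
      map_zero' := by ext; simp
      map_add' := fun z w => by ext; simp }
  have h : Continuous fun p : V × V => F' p.1 p.2 := by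
    change Continuous fun p : V × V => F p.1 p.2
    fun_prop
  have h2 := (Completion.isDenseInducing_toCompl V).extend_Z_bilin
    (Completion.isDenseInducing_toCompl V) h
  have h3 : (fun p : Completion V × Completion V => complForm F p.1 p.2) =
      ((Completion.isDenseInducing_toCompl V).prodMap
        (Completion.isDenseInducing_toCompl V)).extend (fun p : V × V => F p.1 p.2) := rfl
  rw [h3]
  exact h2

@[fun_prop]
theorem _root_.Continuous.complForm {X : Type*} [TopologicalSpace X]
    {f g : X → Completion V} (hf : Continuous f) (hg : Continuous g) :
    Continuous fun t => complForm F (f t) (g t) :=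
  (continuous_complForm F).comp (hf.prodMk hg)

theorem complForm_add_right (z w w' : Completion V) :
    complForm F z (w + w') = complForm F z w + complForm F z w' := by
  induction z, w, w' using Completion.induction_on₃ with
  | hp => exact isClosed_eq (by fun_prop) (by fun_prop)
  | ih a b c => simp only [← Completion.coe_add, complForm_coe, map_add]

theorem complForm_smul_right (t : ℂ) (z w : Completion V) :
    complForm F z (t • w) = t • complForm F z w := by
  induction z, w using Completion.induction_on₂ with
  | hp =>
    have h : Continuous fun p : Completion V × Completion V => t • p.2 :=
      continuous_snd.const_smul t
    exact isClosed_eq (Continuous.complForm F continuous_fst h)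
      ((continuous_complForm F).const_smul t)
  | ih a b => simp only [← Completion.coe_smul, complForm_coe, map_smul]

end

variable {V C : Type*} [SeminormedAddCommGroup V] [NormedSpace ℂ V] [CStarAlgebra C]
  {F : V →L⋆[ℂ] V →L[ℂ] C}

theorem star_complForm (h : ∀ z w, star (F z w) = F w z) (z w : Completion V) :
    star (complForm F z w) = complForm F w z := by
  induction z, w using Completion.induction_on₂ with
  | hp => exact isClosed_eq (by fun_prop) (by fun_prop)
  | ih a b => simp only [complForm_coe, h]

theorem complForm_self_nonneg [PartialOrder C] [StarOrderedRing C] (h : ∀ z, 0 ≤ F z z)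
    (z : Completion V) : 0 ≤ complForm F z z := by
  induction z using Completion.induction_on with
  | hp => exact (CStarAlgebra.isClosed_nonneg).preimage (by fun_prop)
  | ih a => simpa only [complForm_coe] using h a

theorem norm_sq_eq_complForm (h : ∀ z, ‖z‖ ^ 2 = ‖F z z‖) (z : Completion V) :
    ‖z‖ ^ 2 = ‖complForm F z z‖ := by
  induction z using Completion.induction_on with
  | hp => exact isClosed_eq (by fun_prop) (by fun_prop)
  | ih a => simpa only [complForm_coe, Completion.norm_coe] using h a

theorem complForm_self (h : ∀ z, ‖z‖ ^ 2 = ‖F z z‖) (z : Completion V) :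
    complForm F z z = 0 ↔ z = 0 := by
  rw [← norm_eq_zero, ← norm_sq_eq_complForm h]; simp

theorem complForm_ext (h : ∀ z, ‖z‖ ^ 2 = ‖F z z‖) {z w : Completion V}
    (hzw : ∀ u, complForm F u z = complForm F u w) : z = w := by
  rw [← sub_eq_zero, ← complForm_self h]
  have := complForm_add_right F (z - w) (z - w) w
  rw [sub_add_cancel, hzw] at this
  simpa using this

/-- If the coefficients in a dense subspace `S` act on `V`, compatibly with the form, then all
coefficients act on the completion. -/
theorem exists_act (hs : ∀ z w, star (F z w) = F w z) (h : ∀ z, ‖z‖ ^ 2 = ‖F z z‖)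
    {S : Submodule ℂ C} (hS : Dense (S : Set C))
    (hact : ∀ c ∈ S, ∃ v : V →ₗ[ℂ] V, ∀ u u', F u (v u') = c * F u u')
    (c : C) (w : Completion V) : ∃ w', ∀ u, complForm F u w' = c * complForm F u w := by
  -- the coefficients for which the claim holds
  have hS1 : ∀ c ∈ S, ∃ w', ∀ u, complForm F u w' = c * complForm F u w := by
    intro c hc
    obtain ⟨v, hv⟩ := hact c hc
    have hb : ∀ z, ‖v z‖ ≤ ‖c‖ * ‖z‖ := by
      intro z
      refine le_of_sq_le_sq ?_ (by positivity)
      have e : F (v z) (v z) = c * F z z * star c := by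
        rw [hv, ← hs, hv, star_mul, hs, mul_assoc]
      rw [h, e, mul_pow, h]
      calc _ ≤ ‖c‖ * ‖F z z‖ * ‖star c‖ := norm_mul₃_le
        _ = _ := by rw [norm_star]; ring
    let v' : V →L[ℂ] V := v.mkContinuous ‖c‖ hb
    refine ⟨Completion.map v' w, fun u => ?_⟩
    induction u, w using Completion.induction_on₂ with
    | hp =>
      have : Continuous (Completion.map v' : Completion V → Completion V) :=
        Completion.continuous_map
      exact isClosed_eq (by fun_prop) (by fun_prop)
    | ih a b =>
      rw [Completion.map_coe v'.uniformContinuous, complForm_coe, complForm_coe]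
      exact hv a b
  obtain ⟨s, hsmem, hslim⟩ := mem_closure_iff_seq_limit.mp (hS c)
  choose f hf using fun n => hS1 (s n) (hsmem n)
  have hdist : ∀ n k, ‖f n - f k‖ ≤ ‖s n - s k‖ * ‖w‖ := by
    intro n k
    refine le_of_sq_le_sq ?_ (by positivity)
    have e0 : ∀ u, complForm F u (f n - f k) = (s n - s k) * complForm F u w := by
      intro u
      rw [eq_sub_of_add_eq (complForm_add_right F u (f n - f k) (f k)).symm, sub_add_cancel,
        hf, hf, sub_mul]
    have e : complForm F (f n - f k) (f n - f k)
        = (s n - s k) * complForm F w w * star (s n - s k) := by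
      rw [e0, ← star_complForm hs, e0, star_mul, star_complForm hs, mul_assoc]
    rw [norm_sq_eq_complForm h, e, mul_pow, norm_sq_eq_complForm h]
    calc _ ≤ ‖s n - s k‖ * ‖complForm F w w‖ * ‖star (s n - s k)‖ := norm_mul₃_le
      _ = _ := by rw [norm_star]; ring
  have hcauchy : CauchySeq f := by
    have h1 := hslim.cauchySeq
    rw [Metric.cauchySeq_iff'] at h1 ⊢
    intro ε hε
    obtain ⟨N, hN⟩ := h1 (ε / (‖w‖ + 1)) (by positivity)
    refine ⟨N, fun n hn => ?_⟩
    have h2 := hN n hn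
    rw [dist_eq_norm] at h2 ⊢
    have h3 : ‖s n - s N‖ * (‖w‖ + 1) < ε := by
      rwa [lt_div_iff₀ (by positivity)] at h2
    calc _ ≤ _ := hdist n N
      _ ≤ ‖s n - s N‖ * (‖w‖ + 1) := by gcongr; linarith
      _ < ε := h3
  obtain ⟨w', hw'⟩ := cauchySeq_tendsto_of_complete hcauchy
  refine ⟨w', fun u => ?_⟩
  have h1 : Filter.Tendsto (fun n => complForm F u (f n)) Filter.atTop
      (nhds (complForm F u w')) :=
    ((by fun_prop : Continuous fun z => complForm F u z).tendsto w').comp hw'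
  simp only [hf] at h1
  exact tendsto_nhds_unique h1 (hslim.mul_const _)

end Completion
/-- `C` together with this datum is a C⋆-algebraic tensor product of `A` and `B`: unital
⋆-homomorphisms `left : a ↦ a ⊗ 1` and `right : b ↦ 1 ⊗ b` with commuting ranges such that the
elementary tensors `a ⊗ b = left a * right b` span a dense subspace of `C`. -/
structure CStarTensor (A B C : Type*) [CStarAlgebra A] [CStarAlgebra B] [CStarAlgebra C] where
  left : A →⋆ₐ[ℂ] C
  right : B →⋆ₐ[ℂ] C
  commute : ∀ a b, Commute (left a) (right b)
  dense : Dense (Submodule.span ℂ {c : C | ∃ a b, c = left a * right b} : Set C)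

/-- The algebraic tensor product over `ℂ` of a Hilbert `A`-module and a Hilbert `B`-module. -/
def PreTensor {A B C : Type*} [CStarAlgebra A] [CStarAlgebra B] [CStarAlgebra C]
    (_τ : CStarTensor A B C) (M N : Type*) [NormedAddCommGroup M] [NormedSpace ℂ M]
    [NormedAddCommGroup N] [NormedSpace ℂ N] : Type _ := M ⊗[ℂ] N

namespace PreTensor

variable {A B C : Type*} [CStarAlgebra A] [CStarAlgebra B] [CStarAlgebra C]
  (τ : CStarTensor A B C)
  (M N : Type*) [NormedAddCommGroup M] [NormedSpace ℂ M] [NormedAddCommGroup N] [NormedSpace ℂ N]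

noncomputable instance : AddCommGroup (PreTensor τ M N) :=
  inferInstanceAs (AddCommGroup (M ⊗[ℂ] N))

noncomputable instance : Module ℂ (PreTensor τ M N) :=
  inferInstanceAs (Module ℂ (M ⊗[ℂ] N))

variable [PartialOrder A] [StarOrderedRing A] [PartialOrder B] [StarOrderedRing B]
  [Module A M] [CStarModule A M] [Module B N] [CStarModule B N]

/-- The `C`-valued form on `M ⊗ N` (conjugate linear in the first variable) with
`⟨x ⊗ y, x' ⊗ y'⟩ = ⟨x, x'⟩ ⊗ ⟨y, y'⟩`. -/
noncomputable def form : PreTensor τ M N →ₗ⋆[ℂ] PreTensor τ M N →ₗ[ℂ] C :=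
  ((TensorProduct.lift <| TensorProduct.mapBilinear (.id ℂ) M N C C).compr₂
      (LinearMap.mul' ℂ C)) ∘ₛₗ
    TensorProduct.map
      ((CStarModule.innerₛₗ (A := A) (E := M)).compr₂ₛₗ τ.left.toLinearMap)
      ((CStarModule.innerₛₗ (A := B) (E := N)).compr₂ₛₗ τ.right.toLinearMap)


variable {M N}

/-- The elementary tensor `x ⊗ y`. -/
def tmul (x : M) (y : N) : PreTensor τ M N := x ⊗ₜ[ℂ] y

variable {τ}

theorem form_tmul (x x' : M) (y y' : N) :
    form τ M N (tmul τ x y) (tmul τ x' y') =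
      τ.left (inner A x x') * τ.right (inner B y y') := rfl

theorem induction_on {p : PreTensor τ M N → Prop} (z : PreTensor τ M N) (zero : p 0)
    (tmul : ∀ x y, p (tmul τ x y)) (add : ∀ z w, p z → p w → p (z + w)) : p z :=
  TensorProduct.induction_on z zero tmul add

theorem star_form (z w : PreTensor τ M N) : star (form τ M N z w) = form τ M N w z := by
  induction z using induction_on with
  | zero => simp
  | add z z' h h' => simp [h, h']
  | tmul x y =>
    induction w using induction_on with
    | zero => simp
    | add w w' h h' => simp [h, h']
    | tmul x' y' =>
      rw [form_tmul, form_tmul, star_mul, ← map_star, ← map_star, CStarModule.star_inner,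
        CStarModule.star_inner, (τ.commute _ _).eq]

variable [PartialOrder C] [StarOrderedRing C]

theorem form_self_nonneg (z : PreTensor τ M N) : 0 ≤ form τ M N z z := by
  obtain ⟨n, x, y, hz⟩ := TensorProduct.exists_sum_tmul_eq (R := ℂ) (M := M) (N := N) z
  obtain ⟨Y, hY⟩ := exists_gram_factor (A := A) x
  obtain ⟨Z, hZ⟩ := exists_gram_factor (A := B) y
  have hz' : z = ∑ k, tmul τ (x k) (y k) := hz
  have key : form τ M N z z = ∑ r, ∑ s,
      star (∑ k, τ.left (Y r k) * τ.right (Z s k)) * ∑ k, τ.left (Y r k) * τ.right (Z s k) := by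
    have h1 : form τ M N z z = ∑ k, ∑ l, ∑ r, ∑ s,
        (τ.left (star (Y r l)) * τ.left (Y r k)) * (τ.right (star (Z s l)) * τ.right (Z s k)) := by
      rw [hz']
      simp only [map_sum, LinearMap.sum_apply, form_tmul, hY, hZ, Finset.sum_mul_sum, map_mul]
      rw [Finset.sum_comm]
    rw [h1]
    simp only [star_sum, Finset.sum_mul_sum]
    rw [Finset.sum_comm]
    have swap : ∀ F : Fin n → Fin n → Fin n → Fin n → C,
        ∑ l, ∑ k, ∑ r, ∑ s, F l k r s = ∑ r, ∑ s, ∑ l, ∑ k, F l k r s := by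
      intro F
      calc _ = ∑ l, ∑ r, ∑ k, ∑ s, F l k r s :=
            Finset.sum_congr rfl fun l _ => Finset.sum_comm
        _ = ∑ r, ∑ l, ∑ k, ∑ s, F l k r s := Finset.sum_comm
        _ = ∑ r, ∑ l, ∑ s, ∑ k, F l k r s :=
            Finset.sum_congr rfl fun r _ => Finset.sum_congr rfl fun l _ => Finset.sum_comm
        _ = _ := Finset.sum_congr rfl fun r _ => Finset.sum_comm
    rw [swap]
    refine Finset.sum_congr rfl fun r _ => Finset.sum_congr rfl fun s _ =>
      Finset.sum_congr rfl fun l _ => Finset.sum_congr rfl fun k _ => ?_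
    rw [star_mul, ← map_star, ← map_star, ← mul_assoc, ← mul_assoc, mul_assoc (τ.left _),
      (τ.commute (Y r k) (star (Z s l))).eq, ← mul_assoc, (τ.commute (star (Y r l)) _).eq]
  rw [key]
  exact Finset.sum_nonneg fun r _ => Finset.sum_nonneg fun s _ => star_mul_self_nonneg _

/-- The map `x ⊗ y ↦ a x ⊗ b y`. -/
noncomputable def act (a : A) (b : B) : PreTensor τ M N →ₗ[ℂ] PreTensor τ M N :=
  TensorProduct.map (lsmul (M := M) a) (lsmul (M := N) b)

theorem act_tmul (a : A) (b : B) (x : M) (y : N) :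
    act a b (tmul τ x y) = tmul τ (a • x) (b • y) := rfl

theorem form_act (a : A) (b : B) (u u' : PreTensor τ M N) :
    form τ M N u (act a b u') = τ.left a * τ.right b * form τ M N u u' := by
  induction u using induction_on with
  | zero => simp only [map_zero, LinearMap.zero_apply, mul_zero]
  | add u w h h' => simp only [map_add, LinearMap.add_apply, h, h', mul_add]
  | tmul x y =>
    induction u' using induction_on with
    | zero => simp only [map_zero, mul_zero]
    | add u w h h' => simp only [map_add, h, h', mul_add]
    | tmul x' y' =>
      rw [act_tmul, form_tmul, form_tmul, CStarModule.inner_op_smul_right,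
        CStarModule.inner_op_smul_right, map_mul, map_mul, mul_assoc, mul_assoc,
        ← mul_assoc (τ.left (inner A x x')), (τ.commute _ b).eq, mul_assoc]

theorem exists_smul_of_mem {c : C}
    (hc : c ∈ Submodule.span ℂ {c : C | ∃ a b, c = τ.left a * τ.right b}) :
    ∃ v : PreTensor τ M N →ₗ[ℂ] PreTensor τ M N,
      ∀ u u', form τ M N u (v u') = c * form τ M N u u' := by
  induction hc using Submodule.span_induction with
  | mem c hc =>
    obtain ⟨a, b, rfl⟩ := hc
    exact ⟨act a b, form_act a b⟩
  | zero => exact ⟨0, by simp⟩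
  | add c c' _ _ h h' =>
    obtain ⟨v, hv⟩ := h
    obtain ⟨v', hv'⟩ := h'
    exact ⟨v + v', fun u u' => by simp [hv, hv', add_mul]⟩
  | smul t c _ h =>
    obtain ⟨v, hv⟩ := h
    exact ⟨t • v, fun u u' => by simp [hv]⟩

theorem form_mem (z w : PreTensor τ M N) :
    form τ M N z w ∈ Submodule.span ℂ {c : C | ∃ a b, c = τ.left a * τ.right b} := by
  induction z using induction_on with
  | zero => simp
  | add z z' h h' => simpa using add_mem h h'
  | tmul x y =>
    induction w using induction_on with
    | zero => simp
    | add w w' h h' => simpa using add_mem h h'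
    | tmul x' y' => exact Submodule.subset_span ⟨_, _, form_tmul _ _ _ _⟩

theorem norm_form_le (z w : PreTensor τ M N) :
    ‖form τ M N z w‖ ≤ √‖form τ M N z z‖ * √‖form τ M N w w‖ := by
  obtain ⟨v, hv⟩ := exists_smul_of_mem (M := M) (N := N) (form_mem z w)
  set a := form τ M N z w with ha
  have hv' : ∀ u u', form τ M N (v u') u = form τ M N u' u * star a := fun u u' => by
    rw [← star_form, hv, star_mul, star_form]
  have hwz : form τ M N w z = star a := (star_form z w).symm
  have hle : ∀ t : ℝ, ‖form τ M N z z‖ < t → ‖a‖ ^ 2 ≤ t * ‖form τ M N w w‖ := by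
    intro t ht
    have ht0 : 0 < t := (norm_nonneg _).trans_lt ht
    have h0 := form_self_nonneg (v z - (t : ℂ) • w)
    have e : form τ M N (v z - (t : ℂ) • w) (v z - (t : ℂ) • w)
        = a * form τ M N z z * star a - (2 * t) • (a * star a) + (t ^ 2) • form τ M N w w := by
      have e1 : form τ M N ((t : ℂ) • w) = (t : ℂ) • form τ M N w := by
        rw [(form τ M N).map_smulₛₗ, Complex.conj_ofReal]
      rw [(form τ M N).map_sub, LinearMap.sub_apply, map_sub, map_sub, e1, LinearMap.smul_apply,
        LinearMap.smul_apply, map_smul, map_smul, hv', hv, hv, hwz, hv', ← ha]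
      simp only [Complex.coe_smul, smul_smul, two_mul, add_smul, pow_two, mul_assoc]
      abel
    rw [e] at h0
    have h1 : a * form τ M N z z * star a ≤ t • (a * star a) :=
      (CStarAlgebra.star_right_conjugate_le_norm_smul
        (hb := IsSelfAdjoint.of_nonneg (form_self_nonneg z))).trans
        (smul_le_smul_of_nonneg_right ht.le (mul_star_self_nonneg a))
    have h2 : a * star a ≤ t • form τ M N w w := by
      have h3 : 0 ≤ t • (t • form τ M N w w - a * star a) := by
        refine h0.trans ?_
        rw [smul_sub, smul_smul, ← pow_two]
        have : a * form τ M N z z * star a - (2 * t) • (a * star a) ≤ - (t • (a * star a)) := by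
          rw [two_mul, add_smul, sub_le_iff_le_add]
          simpa using h1
        calc _ ≤ - (t • (a * star a)) + t ^ 2 • form τ M N w w := by gcongr
          _ = _ := by abel
      have h4 := smul_nonneg (inv_nonneg.mpr ht0.le) h3
      rw [smul_smul, inv_mul_cancel₀ ht0.ne', one_smul] at h4
      exact sub_nonneg.mp h4
    calc ‖a‖ ^ 2 = ‖a * star a‖ := by rw [CStarRing.norm_self_mul_star, pow_two]
      _ ≤ ‖t • form τ M N w w‖ :=
          CStarAlgebra.norm_le_norm_of_nonneg_of_le (mul_star_self_nonneg a) h2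
      _ = t * ‖form τ M N w w‖ := by rw [norm_smul, Real.norm_of_nonneg ht0.le]
  rw [← Real.sqrt_mul (norm_nonneg _)]
  apply Real.le_sqrt_of_sq_le
  have hc : Filter.Tendsto (fun t : ℝ => t * ‖form τ M N w w‖)
      (nhdsWithin ‖form τ M N z z‖ (Set.Ioi ‖form τ M N z z‖))
      (nhds (‖form τ M N z z‖ * ‖form τ M N w w‖)) :=
    ((continuous_id.mul continuous_const).tendsto _).mono_left nhdsWithin_le_nhds
  exact ge_of_tendsto hc (Filter.eventually_of_mem self_mem_nhdsWithin fun t ht => hle t ht)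


/-- The seminorm `‖z‖ = ‖⟨z, z⟩‖ ^ (1 / 2)`. -/
noncomputable instance : Norm (PreTensor τ M N) := ⟨fun z => √‖form τ M N z z‖⟩

theorem norm_def (z : PreTensor τ M N) : ‖z‖ = √‖form τ M N z z‖ := rfl

theorem norm_sq (z : PreTensor τ M N) : ‖z‖ ^ 2 = ‖form τ M N z z‖ :=
  Real.sq_sqrt (norm_nonneg _)

theorem seminormCore : SeminormedSpace.Core ℂ (PreTensor τ M N) where
  norm_nonneg z := Real.sqrt_nonneg _
  norm_smul c z := by
    rw [norm_def, norm_def, (form τ M N).map_smulₛₗ, LinearMap.smul_apply, map_smul, smul_smul,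
      norm_smul, norm_mul, RCLike.norm_conj, Real.sqrt_mul (by positivity),
      Real.sqrt_mul_self (norm_nonneg c)]
  norm_triangle z w := by
    refine abs_le_of_sq_le_sq' ?_ (add_nonneg (Real.sqrt_nonneg _) (Real.sqrt_nonneg _)) |>.2
    have h1 : ‖form τ M N z w‖ ≤ ‖z‖ * ‖w‖ := norm_form_le z w
    have h2 : ‖form τ M N w z‖ ≤ ‖w‖ * ‖z‖ := norm_form_le w z
    rw [norm_sq]
    calc _ = ‖form τ M N z z + form τ M N z w + form τ M N w z + form τ M N w w‖ := by
          simp only [map_add, LinearMap.add_apply]; congr 1; abel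
      _ ≤ ‖form τ M N z z‖ + ‖form τ M N z w‖ + ‖form τ M N w z‖ + ‖form τ M N w w‖ :=
          norm_add₄_le
      _ ≤ (‖z‖ + ‖w‖) ^ 2 := by rw [← norm_sq, ← norm_sq]; nlinarith

noncomputable instance : SeminormedAddCommGroup (PreTensor τ M N) :=
  SeminormedAddCommGroup.ofCore seminormCore

noncomputable instance : NormedSpace ℂ (PreTensor τ M N) where
  norm_smul_le c z := (seminormCore.norm_smul c z).le

/-- The form as a continuous sesquilinear map. -/
noncomputable def formL : PreTensor τ M N →L⋆[ℂ] PreTensor τ M N →L[ℂ] C :=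
  LinearMap.mkContinuous₂ (form τ M N) 1 fun z w => by
    rw [one_mul]; exact norm_form_le z w

theorem formL_apply (z w : PreTensor τ M N) : formL z w = form τ M N z w := rfl

end PreTensor

/-- The tensor product Hilbert `C`-module `M ⊗ N`: the completion of the algebraic tensor product
with respect to the norm of its `C`-valued inner product. -/
def ExtTensor {A B C : Type*} [CStarAlgebra A] [CStarAlgebra B] [CStarAlgebra C]
    [PartialOrder A] [StarOrderedRing A] [PartialOrder B] [StarOrderedRing B]
    [PartialOrder C] [StarOrderedRing C] (τ : CStarTensor A B C)
    (M N : Type*) [NormedAddCommGroup M] [NormedSpace ℂ M] [Module A M] [CStarModule A M]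
    [NormedAddCommGroup N] [NormedSpace ℂ N] [Module B N] [CStarModule B N] : Type _ :=
  UniformSpace.Completion (PreTensor τ M N)

namespace ExtTensor

variable {A B C : Type*} [CStarAlgebra A] [CStarAlgebra B] [CStarAlgebra C]
  [PartialOrder A] [StarOrderedRing A] [PartialOrder B] [StarOrderedRing B]
  [PartialOrder C] [StarOrderedRing C] {τ : CStarTensor A B C}
  {M N : Type*} [NormedAddCommGroup M] [NormedSpace ℂ M] [Module A M] [CStarModule A M]
  [NormedAddCommGroup N] [NormedSpace ℂ N] [Module B N] [CStarModule B N]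

noncomputable instance : NormedAddCommGroup (ExtTensor τ M N) :=
  inferInstanceAs (NormedAddCommGroup (UniformSpace.Completion (PreTensor τ M N)))

noncomputable instance : NormedSpace ℂ (ExtTensor τ M N) :=
  inferInstanceAs (NormedSpace ℂ (UniformSpace.Completion (PreTensor τ M N)))

instance : CompleteSpace (ExtTensor τ M N) :=
  inferInstanceAs (CompleteSpace (UniformSpace.Completion (PreTensor τ M N)))

/-- The inner product of the algebraic tensor product, extended by continuity. -/
noncomputable instance : Inner C (ExtTensor τ M N) :=
  ⟨fun z w => complForm (PreTensor.formL (τ := τ) (M := M) (N := N)) z w⟩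

/-- The canonical isometric map from the algebraic tensor product to its completion. -/
noncomputable def ofPre : PreTensor τ M N →L[ℂ] ExtTensor τ M N :=
  UniformSpace.Completion.toComplL

variable (τ) in
/-- The elementary tensor `x ⊗ y`. -/
noncomputable def tmul (x : M) (y : N) : ExtTensor τ M N := ofPre (PreTensor.tmul τ x y)

theorem inner_tmul (x x' : M) (y y' : N) :
    (inner C (tmul τ x y) (tmul τ x' y') : C) =
      τ.left (inner A x x') * τ.right (inner B y y') :=
  complForm_coe _ _ _

theorem exists_smul (c : C) (w : ExtTensor τ M N) :
    ∃ w' : ExtTensor τ M N, ∀ u : ExtTensor τ M N, (inner C u w' : C) = c * inner C u w :=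
  exists_act (F := PreTensor.formL (τ := τ) (M := M) (N := N)) PreTensor.star_form
    PreTensor.norm_sq τ.dense (fun _ hc => PreTensor.exists_smul_of_mem hc) c w

theorem ext_inner {z w : ExtTensor τ M N}
    (h : ∀ u : ExtTensor τ M N, (inner C u z : C) = inner C u w) : z = w :=
  complForm_ext (F := PreTensor.formL (τ := τ) (M := M) (N := N)) PreTensor.norm_sq h

theorem inner_add_right (z w w' : ExtTensor τ M N) :
    (inner C z (w + w') : C) = inner C z w + inner C z w' :=
  complForm_add_right (PreTensor.formL (τ := τ) (M := M) (N := N)) z w w'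

/-- The action of `C`: `c • w` is the unique vector with `⟨u, c • w⟩ = c * ⟨u, w⟩` for all `u`
(`inner` being linear in the second variable); on elementary tensors
`(a ⊗ b) • (x ⊗ y) = a x ⊗ b y`. -/
noncomputable instance : SMul C (ExtTensor τ M N) := ⟨fun c w => (exists_smul c w).choose⟩

theorem inner_smul_right (c : C) (u w : ExtTensor τ M N) :
    (inner C u (c • w) : C) = c * inner C u w := (exists_smul c w).choose_spec u

theorem smul_tmul (a : A) (b : B) (x : M) (y : N) :
    (τ.left a * τ.right b) • tmul τ x y = tmul τ (a • x) (b • y) := by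
  refine ext_inner fun u => ?_
  rw [inner_smul_right]
  have h : Continuous fun u : ExtTensor τ M N => (inner C u (tmul τ x y) : C) :=
    Continuous.complForm (PreTensor.formL (τ := τ) (M := M) (N := N)) continuous_id
      continuous_const
  have h' : Continuous fun u : ExtTensor τ M N => (inner C u (tmul τ (a • x) (b • y)) : C) :=
    Continuous.complForm (PreTensor.formL (τ := τ) (M := M) (N := N)) continuous_id
      continuous_const
  refine UniformSpace.Completion.induction_on (α := PreTensor τ M N)
    (p := fun u : ExtTensor τ M N => τ.left a * τ.right b * (inner C u (tmul τ x y) : C) =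
      inner C u (tmul τ (a • x) (b • y))) u (isClosed_eq (h.const_mul _) h') fun v => ?_
  have e1 : (inner C (ofPre v : ExtTensor τ M N) (tmul τ x y) : C) =
    PreTensor.form τ M N v (PreTensor.tmul τ x y) := complForm_coe _ _ _
  have e2 : (inner C (ofPre v : ExtTensor τ M N) (tmul τ (a • x) (b • y)) : C) =
    PreTensor.form τ M N v (PreTensor.tmul τ (a • x) (b • y)) := complForm_coe _ _ _
  change τ.left a * τ.right b * (inner C (ofPre v : ExtTensor τ M N) (tmul τ x y) : C) =
    inner C (ofPre v : ExtTensor τ M N) (tmul τ (a • x) (b • y))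
  rw [e1, e2, ← PreTensor.act_tmul, PreTensor.form_act]

noncomputable instance : Module C (ExtTensor τ M N) where
  one_smul w := ext_inner (C := C) fun u => by rw [inner_smul_right, one_mul]
  mul_smul c d w := ext_inner (C := C) fun u => by
    rw [inner_smul_right, inner_smul_right, inner_smul_right, mul_assoc]
  smul_zero c := ext_inner (C := C) fun u => by
    have h := inner_add_right (C := C) u 0 0
    rw [add_zero, left_eq_add] at h
    rw [inner_smul_right, h, mul_zero]
  smul_add c w w' := ext_inner (C := C) fun u => by
    rw [inner_smul_right, inner_add_right, inner_add_right, inner_smul_right, inner_smul_right,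
      mul_add]
  add_smul c d w := ext_inner (C := C) fun u => by
    rw [inner_smul_right, inner_add_right, inner_smul_right, inner_smul_right, add_mul]
  zero_smul w := ext_inner (C := C) fun u => by
    have h := inner_add_right (C := C) u 0 0
    rw [add_zero, left_eq_add] at h
    rw [inner_smul_right, h, zero_mul]

/-- `M ⊗ N` is a Hilbert `C`-module. -/
noncomputable instance : CStarModule C (ExtTensor τ M N) where
  inner_add_right := inner_add_right _ _ _
  inner_self_nonneg := complForm_self_nonneg PreTensor.form_self_nonneg _
  inner_self := complForm_self PreTensor.norm_sq _
  inner_op_smul_right := inner_smul_right _ _ _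
  inner_smul_right_complex := complForm_smul_right _ _ _ _
  star_inner z w := star_complForm PreTensor.star_form z w
  norm_eq_sqrt_norm_inner_self z := by
    have h := norm_sq_eq_complForm (F := PreTensor.formL (τ := τ) (M := M) (N := N))
      PreTensor.norm_sq z
    exact ((Real.sqrt_eq_iff_mul_self_eq (norm_nonneg _) (norm_nonneg z)).mpr
      (h.symm.trans (pow_two _))).symm

/-- The operator `S ⊗ T` on `M ⊗ N`: the continuous extension of `x ⊗ y ↦ S x ⊗ T y`. -/
noncomputable def map (S : M →L[ℂ] M) (T : N →L[ℂ] N) : ExtTensor τ M N →L[ℂ] ExtTensor τ M N :=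
  LinearMap.extendOfNorm
    ((ofPre : PreTensor τ M N →L[ℂ] ExtTensor τ M N).toLinearMap ∘ₗ
      (TensorProduct.map S.toLinearMap T.toLinearMap : PreTensor τ M N →ₗ[ℂ] PreTensor τ M N))
    (ofPre : PreTensor τ M N →L[ℂ] ExtTensor τ M N).toLinearMap

end ExtTensor


/-- The commutative case: `A = B = C` with `a ⊗ b = a b`. Here `M ⊗ N` is the balanced tensor
product `M ⊗_A N` with `⟨x ⊗ y, x' ⊗ y'⟩ = ⟨x, x'⟩ ⟨y, y'⟩`. -/
def CStarTensor.balanced (A : Type*) [CommCStarAlgebra A] : CStarTensor A A A where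
  left := StarAlgHom.id ℂ A
  right := StarAlgHom.id ℂ A
  commute a b := mul_comm a b
  dense := by
    have h : Submodule.span ℂ {c : A | ∃ a b, c = StarAlgHom.id ℂ A a * StarAlgHom.id ℂ A b} = ⊤ :=
      eq_top_iff.mpr fun c _ => Submodule.subset_span ⟨c, 1, by simp⟩
    rw [h]
    exact dense_univ

section Generated

variable {A B D : Type*} [CStarAlgebra A] [CStarAlgebra B] [CStarAlgebra D]
  (φ : A →⋆ₐ[ℂ] D) (ψ : B →⋆ₐ[ℂ] D) (h : ∀ a b, Commute (φ a) (ψ b))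

/-- The closed star subalgebra generated by two commuting star homomorphisms. -/
noncomputable def generated : StarSubalgebra ℂ D :=
  StarSubalgebra.topologicalClosure
  { carrier := Submodule.span ℂ {c : D | ∃ a b, c = φ a * ψ b}
    zero_mem' := zero_mem _
    add_mem' := add_mem
    algebraMap_mem' := fun r => by
      rw [Algebra.algebraMap_eq_smul_one]
      exact Submodule.smul_mem _ r (Submodule.subset_span ⟨1, 1, by simp⟩)
    mul_mem' := fun {x y} hx hy => by
      induction hx, hy using Submodule.span_induction₂ with
      | mem_mem x y hx hy =>
        obtain ⟨a, b, rfl⟩ := hx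
        obtain ⟨a', b', rfl⟩ := hy
        refine Submodule.subset_span ⟨a * a', b * b', ?_⟩
        rw [map_mul, map_mul, mul_assoc, ← mul_assoc (ψ b), ← (h a' b).eq]
        simp only [mul_assoc]
      | zero_left y hy => rw [zero_mul]; exact zero_mem _
      | zero_right x hx => rw [mul_zero]; exact zero_mem _
      | add_left x y z _ _ _ hxz hyz => rw [add_mul]; exact add_mem hxz hyz
      | add_right x y z _ _ _ hxy hxz => rw [mul_add]; exact add_mem hxy hxz
      | smul_left r x y _ _ hxy => rw [smul_mul_assoc]; exact Submodule.smul_mem _ r hxy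
      | smul_right r x y _ _ hxy => rw [mul_smul_comm]; exact Submodule.smul_mem _ r hxy
    star_mem' := fun {x} hx => by
      induction hx using Submodule.span_induction with
      | mem x hx =>
        obtain ⟨a, b, rfl⟩ := hx
        refine Submodule.subset_span ⟨star a, star b, ?_⟩
        rw [star_mul, ← map_star, ← map_star, (h _ _).eq]
      | zero => rw [star_zero]; exact zero_mem _
      | add x y _ _ hx hy => rw [star_add]; exact add_mem hx hy
      | smul r x _ hx => rw [star_smul]; exact Submodule.smul_mem _ _ hx }

theorem coe_generated : (generated φ ψ h : Set D) =
    closure (Submodule.span ℂ {c : D | ∃ a b, c = φ a * ψ b} : Set D) := rfl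

instance : IsClosed (generated φ ψ h : Set D) := by
  rw [coe_generated]; exact isClosed_closure

/-- The C⋆-algebra generated by two commuting star homomorphisms. -/
def Generated : Type _ := generated φ ψ h

noncomputable instance : CStarAlgebra (Generated φ ψ h) :=
  inferInstanceAs (CStarAlgebra (generated φ ψ h))

theorem mul_mem_generated (a : A) (b : B) : φ a * ψ b ∈ generated φ ψ h :=
  subset_closure (Submodule.subset_span ⟨a, b, rfl⟩)

theorem dense_generated : Dense (Submodule.span ℂ {c : generated φ ψ h | ∃ a b,
    c = ⟨φ a * ψ b, mul_mem_generated φ ψ h a b⟩} : Set (generated φ ψ h)) := fun c => by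
  refine (closure_subtype (X := D) (p := fun x => x ∈ generated φ ψ h) (x := c)).mpr ?_
  have hc : (c : D) ∈ closure (Submodule.span ℂ {c : D | ∃ a b, c = φ a * ψ b} : Set D) := c.2
  refine closure_mono ?_ hc
  intro d hd
  induction hd using Submodule.span_induction with
  | mem d hd =>
    obtain ⟨a, b, rfl⟩ := hd
    exact ⟨⟨_, mul_mem_generated φ ψ h a b⟩, Submodule.subset_span ⟨a, b, rfl⟩, rfl⟩
  | zero => exact ⟨0, zero_mem _, rfl⟩
  | add x y _ _ hx hy =>
    obtain ⟨x, hx, rfl⟩ := hx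
    obtain ⟨y, hy, rfl⟩ := hy
    exact ⟨x + y, add_mem hx hy, rfl⟩
  | smul r x _ hx =>
    obtain ⟨x, hx, rfl⟩ := hx
    exact ⟨r • x, Submodule.smul_mem _ r hx, rfl⟩

/-- Two commuting star homomorphisms make the C⋆-algebra that they generate a tensor product. -/
noncomputable def CStarTensor.ofCommute : CStarTensor A B (Generated φ ψ h) where
  left := φ.codRestrict (generated φ ψ h) fun a => by simpa using mul_mem_generated φ ψ h a 1
  right := ψ.codRestrict (generated φ ψ h) fun b => by simpa using mul_mem_generated φ ψ h 1 b
  commute a b := Subtype.ext (h a b)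
  dense := dense_generated φ ψ h

end Generated

section Spatial

open UniformSpace

variable {H K : Type*} [NormedAddCommGroup H] [InnerProductSpace ℂ H] [CompleteSpace H]
  [NormedAddCommGroup K] [InnerProductSpace ℂ K] [CompleteSpace K]

variable (H K) in
/-- The Hilbert space tensor product. -/
abbrev HilbertTensor := Completion (H ⊗[ℂ] K)

theorem hilbertTensor_ext {S T : HilbertTensor H K →L[ℂ] HilbertTensor H K}
    (h : ∀ x y, S ((x ⊗ₜ[ℂ] y : H ⊗[ℂ] K) : HilbertTensor H K) =
      T ((x ⊗ₜ[ℂ] y : H ⊗[ℂ] K) : HilbertTensor H K)) : S = T := by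
  ext z
  induction z using Completion.induction_on with
  | hp => exact isClosed_eq (by fun_prop) (by fun_prop)
  | ih a =>
    induction a using TensorProduct.induction_on with
    | zero => rw [Completion.coe_zero, map_zero, map_zero]
    | tmul x y => exact h x y
    | add x y hx hy => rw [Completion.coe_add, map_add, map_add, hx, hy]

/-- The bounded operator `S ⊗ T` on the Hilbert space tensor product. -/
noncomputable def hilbertMap (S : H →L[ℂ] H) (T : K →L[ℂ] K) :
    HilbertTensor H K →L[ℂ] HilbertTensor H K :=
  (Completion.toComplL (𝕜 := ℂ) ∘L TensorProduct.mapL S T).extend Completion.toComplL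

theorem hilbertMap_coe (S : H →L[ℂ] H) (T : K →L[ℂ] K) (z : H ⊗[ℂ] K) :
    hilbertMap S T (z : HilbertTensor H K) = (TensorProduct.mapL S T z : HilbertTensor H K) :=
  ContinuousLinearMap.extend_eq (e := Completion.toComplL (𝕜 := ℂ)) _
    Completion.denseRange_coe (Completion.isUniformInducing_coe _) z

theorem hilbertMap_tmul (S : H →L[ℂ] H) (T : K →L[ℂ] K) (x : H) (y : K) :
    hilbertMap S T ((x ⊗ₜ[ℂ] y : H ⊗[ℂ] K) : HilbertTensor H K) =
      ((S x ⊗ₜ[ℂ] T y : H ⊗[ℂ] K) : HilbertTensor H K) :=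
  hilbertMap_coe S T _

theorem hilbertMap_mul (S S' : H →L[ℂ] H) (T T' : K →L[ℂ] K) :
    hilbertMap (S * S') (T * T') = hilbertMap S T * hilbertMap S' T' :=
  hilbertTensor_ext fun x y => by
    simp [hilbertMap_tmul]

theorem hilbertMap_star (S : H →L[ℂ] H) (T : K →L[ℂ] K) :
    hilbertMap (star S) (star T) = star (hilbertMap S T) := by
  rw [ContinuousLinearMap.star_eq_adjoint (hilbertMap S T), ContinuousLinearMap.eq_adjoint_iff]
  intro z w
  induction z, w using Completion.induction_on₂ with
  | hp => exact isClosed_eq (by fun_prop) (by fun_prop)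
  | ih a b =>
    rw [hilbertMap_coe, hilbertMap_coe, Completion.inner_coe, Completion.inner_coe]
    induction a using TensorProduct.induction_on with
    | zero => simp
    | add x y hx hy => simp only [map_add, inner_add_left, hx, hy]
    | tmul x y =>
      induction b using TensorProduct.induction_on with
      | zero => simp
      | add x y hx hy => simp only [map_add, inner_add_right, hx, hy]
      | tmul x' y' =>
        rw [TensorProduct.mapL_tmul, TensorProduct.mapL_tmul, TensorProduct.inner_tmul,
          TensorProduct.inner_tmul, ContinuousLinearMap.star_eq_adjoint,
          ContinuousLinearMap.star_eq_adjoint, ContinuousLinearMap.adjoint_inner_left,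
          ContinuousLinearMap.adjoint_inner_left]

variable (H K) in
/-- The C⋆-algebra of bounded operators on `H ⊗ K`. -/
def TensorOps : Type _ := HilbertTensor H K →L[ℂ] HilbertTensor H K

noncomputable instance : CStarAlgebra (TensorOps H K) :=
  inferInstanceAs (CStarAlgebra (HilbertTensor H K →L[ℂ] HilbertTensor H K))

theorem smul_one_left (c : ℂ) :
    hilbertMap (algebraMap ℂ (H →L[ℂ] H) c) (1 : K →L[ℂ] K) = algebraMap ℂ _ c :=
  hilbertTensor_ext fun x y => by
    simp [hilbertMap_tmul, Algebra.algebraMap_eq_smul_one, ← TensorProduct.smul_tmul',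
      Completion.coe_smul]

theorem smul_one_right (c : ℂ) :
    hilbertMap (1 : H →L[ℂ] H) (algebraMap ℂ (K →L[ℂ] K) c) = algebraMap ℂ _ c :=
  hilbertTensor_ext fun x y => by
    simp [hilbertMap_tmul, Algebra.algebraMap_eq_smul_one]

theorem add_one_left (S T : H →L[ℂ] H) :
    hilbertMap (S + T) (1 : K →L[ℂ] K) = hilbertMap S 1 + hilbertMap T 1 :=
  hilbertTensor_ext fun x y => by
    simp [hilbertMap_tmul, TensorProduct.add_tmul, Completion.coe_add]

theorem add_one_right (S T : K →L[ℂ] K) :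
    hilbertMap (1 : H →L[ℂ] H) (S + T) = hilbertMap 1 S + hilbertMap 1 T :=
  hilbertTensor_ext fun x y => by
    simp [hilbertMap_tmul, TensorProduct.tmul_add, Completion.coe_add]

theorem zero_one_left : hilbertMap (0 : H →L[ℂ] H) (1 : K →L[ℂ] K) = 0 :=
  hilbertTensor_ext fun x y => by simp [hilbertMap_tmul]

theorem zero_one_right : hilbertMap (1 : H →L[ℂ] H) (0 : K →L[ℂ] K) = 0 :=
  hilbertTensor_ext fun x y => by simp [hilbertMap_tmul]

theorem one_one : hilbertMap (1 : H →L[ℂ] H) (1 : K →L[ℂ] K) = 1 :=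
  hilbertTensor_ext fun x y => by simp [hilbertMap_tmul]

variable (H K) in
/-- `S ↦ S ⊗ 1`. -/
noncomputable def leftAmplification : (H →L[ℂ] H) →⋆ₐ[ℂ] TensorOps H K where
  toFun S := hilbertMap S 1
  map_one' := one_one
  map_mul' S T := (congrArg (hilbertMap (S * T)) (one_mul 1).symm).trans (hilbertMap_mul S T 1 1)
  map_zero' := zero_one_left
  map_add' S T := add_one_left S T
  commutes' c := smul_one_left c
  map_star' S := (congrArg (hilbertMap (star S)) (star_one _).symm).trans (hilbertMap_star S 1)

variable (H K) in
/-- `T ↦ 1 ⊗ T`. -/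
noncomputable def rightAmplification : (K →L[ℂ] K) →⋆ₐ[ℂ] TensorOps H K where
  toFun T := hilbertMap 1 T
  map_one' := one_one
  map_mul' S T :=
    (congrArg (fun R => hilbertMap R (S * T)) (one_mul 1).symm).trans (hilbertMap_mul 1 1 S T)
  map_zero' := zero_one_right
  map_add' S T := add_one_right S T
  commutes' c := smul_one_right c
  map_star' S :=
    (congrArg (fun R => hilbertMap R (star S)) (star_one _).symm).trans (hilbertMap_star 1 S)

variable {A B : Type*} [CStarAlgebra A] [CStarAlgebra B]

theorem amplification_commute (S : H →L[ℂ] H) (T : K →L[ℂ] K) :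
    Commute (leftAmplification H K S) (rightAmplification H K T) := by
  have h : hilbertMap S 1 * hilbertMap 1 T = hilbertMap 1 T * hilbertMap S 1 := by
    rw [← hilbertMap_mul, ← hilbertMap_mul, one_mul, mul_one, one_mul, mul_one]
  exact h

/-- The spatial tensor product: the C⋆-algebra on `H ⊗ K` generated by `π a ⊗ 1` and `1 ⊗ ρ b`,
where `π` and `ρ` are (faithful) representations on `H` and `K`. -/
def SpatialTensor (π : A →⋆ₐ[ℂ] (H →L[ℂ] H)) (ρ : B →⋆ₐ[ℂ] (K →L[ℂ] K)) : Type _ :=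
  Generated (D := TensorOps H K)
    ((leftAmplification H K).comp π) ((rightAmplification H K).comp ρ)
    fun a b => amplification_commute (π a) (ρ b)

noncomputable instance (π : A →⋆ₐ[ℂ] (H →L[ℂ] H)) (ρ : B →⋆ₐ[ℂ] (K →L[ℂ] K)) :
    CStarAlgebra (SpatialTensor π ρ) :=
  instCStarAlgebraGenerated (D := TensorOps H K)
    ((leftAmplification H K).comp π) ((rightAmplification H K).comp ρ)
    fun a b => amplification_commute (π a) (ρ b)

/-- The spatial case: `C = A ⊗ B` is the spatial tensor product. Here `M ⊗ N` is the exterior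
tensor product of `M` and `N`. -/
noncomputable def CStarTensor.spatial (π : A →⋆ₐ[ℂ] (H →L[ℂ] H)) (ρ : B →⋆ₐ[ℂ] (K →L[ℂ] K)) :
    CStarTensor A B (SpatialTensor π ρ) :=
  CStarTensor.ofCommute (D := TensorOps H K)
    ((leftAmplification H K).comp π) ((rightAmplification H K).comp ρ)
    fun a b => amplification_commute (π a) (ρ b)

end Spatial

section Bessel

open MeasureTheory

variable (D : Type*) [CStarAlgebra D] {E Ω : Type*} [NormedAddCommGroup E] [NormedSpace ℂ E]
  [Module D E] [MeasurableSpace Ω]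

/-- The `D`-valued inner product of a left Hilbert `D`-module `E`, linear in the first variable:
`⟨a x, y⟩ = a ⟨x, y⟩`. -/
def ip [Inner D E] (x y : E) : D := inner D y x

/-- `(X, Y)` is a continuous biframe Bessel mapping, tested on the vectors `f` in `S`: the maps
`⟨f, X ω⟩` and `⟨f, Y ω⟩` are measurable and, for some `K > 0`,
`∫ ⟨f, X ω⟩ ⟨Y ω, f⟩ dμ ≤ K ⟨f, f⟩`. -/
structure IsBesselOn [PartialOrder D] [StarOrderedRing D] [CStarModule D E] (S : Set E)
    (μ : Measure Ω) (X Y : Ω → E) : Prop where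
  stronglyMeasurable_left : ∀ f ∈ S, StronglyMeasurable fun ω => ip D f (X ω)
  stronglyMeasurable_right : ∀ f ∈ S, StronglyMeasurable fun ω => ip D f (Y ω)
  integrable : ∀ f ∈ S, Integrable (fun ω => ip D f (X ω) * ip D (Y ω) f) μ
  bound : ∃ K : ℝ, 0 < K ∧
    ∀ f ∈ S, ∫ ω, ip D f (X ω) * ip D (Y ω) f ∂μ ≤ K • ip D f f

/-- `T` is the Bessel multiplier `f ↦ ∫ m ⟨f, X⟩ Y dμ`, a Bochner integral in `E` for all `f` in
`S`. -/
def IsMultiplierOn [PartialOrder D] [StarOrderedRing D] [CStarModule D E] (S : Set E)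
    (μ : Measure Ω) (m : Ω → ℂ) (X Y : Ω → E) (T : E →L[ℂ] E) : Prop :=
  ∀ f ∈ S, Integrable (fun ω => m ω • (ip D f (X ω) • Y ω)) μ ∧
    T f = ∫ ω, m ω • (ip D f (X ω) • Y ω) ∂μ

/-- `T` is the Bessel multiplier `f ↦ ∫ m ⟨f, X⟩ Y dμ` in the weak sense:
`⟨T f, g⟩ = ∫ m ⟨f, X⟩ ⟨Y, g⟩ dμ` for all `f` and `g` in `S`. -/
def IsWeakMultiplierOn [PartialOrder D] [StarOrderedRing D] [CStarModule D E] (S : Set E)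
    (μ : Measure Ω) (m : Ω → ℂ) (X Y : Ω → E) (T : E →L[ℂ] E) : Prop :=
  ∀ f ∈ S, ∀ g ∈ S, Integrable (fun ω => m ω • (ip D f (X ω) * ip D (Y ω) g)) μ ∧
    ip D (T f) g = ∫ ω, m ω • (ip D f (X ω) * ip D (Y ω) g) ∂μ

/-- `T` has an adjoint with respect to the `D`-valued inner product. -/
def IsAdjointable [PartialOrder D] [StarOrderedRing D] [CStarModule D E] (T : E →L[ℂ] E) : Prop :=
  ∃ T' : E →L[ℂ] E, ∀ x y, ip D (T x) y = ip D x (T' y)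

end Bessel

/-- The set of pure tensors `x ⊗ y` in `M ⊗ N`. -/
def pureTensors {A B C : Type*} [CStarAlgebra A] [CStarAlgebra B] [CStarAlgebra C]
    [PartialOrder A] [StarOrderedRing A] [PartialOrder B] [StarOrderedRing B]
    [PartialOrder C] [StarOrderedRing C] (τ : CStarTensor A B C)
    (M N : Type*) [NormedAddCommGroup M] [NormedSpace ℂ M] [Module A M] [CStarModule A M]
    [NormedAddCommGroup N] [NormedSpace ℂ N] [Module B N] [CStarModule B N] :
    Set (ExtTensor τ M N) :=
  {z | ∃ x y, z = ExtTensor.tmul τ x y}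

end BesselTensor

open MeasureTheory BesselTensor

/-! Every integrand on the product space is an elementary tensor of an integrand on `Ω₁` and one on
`Ω₂` (`ip_mul_ip_tmul`, using the commuting ranges). Fubini for the bounded bilinear maps `mulL` and
`tmulL` therefore turns each integral over the product into the tensor product of two integrals.
What remains is the order in `C` and the boundedness of `T₁ ⊗ T₂`.

Bessel bound: `p ≤ a` and `q ≤ b` do not imply `p ⊗ q ≤ a ⊗ b`, since `p` and `q` may both be very
negative; lower bounds are needed too, and the definition gives none. They come from completeness.
The closed graph theorem and uniform boundedness give `‖p f‖ ≤ L ‖f‖²` for the form `p f = ∫ ⟨f,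
X⟩⟨Y, f⟩` (`exists_norm_integral_ip_le`). As `a * p f * star a = p (a • f)`, this norm bound
controls all compressions of `p f`, and `le_smul_of_norm_conjugate_le` converts it into `± p f ≤ L
⟨f, f⟩`. Then `mulL_le` multiplies the two-sided bounds.

Multipliers: `⟨f, X⟩` is `A`-linear in `f`, so a multiplier is a module map. A bounded module map
satisfies `⟨T x, T x⟩ ≤ ‖T‖² ⟨x, x⟩`, also at the level of Gram matrices, and a Schur product
argument yields `‖S ⊗ T‖ ≤ ‖S‖ ‖T‖` on the algebraic tensor product (`norm_map_le`). Uniqueness and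
adjointability follow from the density of the span of the pure tensors. -/

namespace BesselTensor

set_option linter.unusedSectionVars false

/-! ### Operator inequalities from norms of compressions. -/

section Order

variable {A : Type*} [CStarAlgebra A] [PartialOrder A] [StarOrderedRing A]

/-- A selfadjoint element `p` is at most `L g` if every compression `a p a*` has norm at most
`L ‖a g a*‖`. -/
theorem le_smul_of_norm_conjugate_le {p g : A} (hp : IsSelfAdjoint p) (hg : 0 ≤ g) {L : ℝ}
    (hL : 0 ≤ L) (h : ∀ a : A, ‖a * p * star a‖ ≤ L * ‖a * g * star a‖) : p ≤ L • g := by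
  -- `g` need not be invertible, so it is replaced by `q = g + ε`. Compressing by `r = q ^ (-1/2)`
  -- gives `r g r ≤ r q r = 1`, hence `‖r p r‖ ≤ L`; conjugating `r p r ≤ L` back by `c = q ^ (1/2)`
  -- gives `p ≤ L q`.
  have hε : ∀ ε : ℝ, 0 < ε → p ≤ L • (g + algebraMap ℝ A ε) := by
    intro ε hε
    set q := g + algebraMap ℝ A ε with hq
    have hq0 : IsStrictlyPositive q :=
      IsStrictlyPositive.nonneg_add hg
        ((IsUnit.map (algebraMap ℝ A) (IsUnit.mk0 ε hε.ne')).isStrictlyPositive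
          (algebraMap_nonneg A hε.le))
    set c := q ^ (1 / 2 : ℝ) with hc
    set r := q ^ (-(1 / 2) : ℝ) with hr
    have hcr : c * r = 1 := CFC.rpow_mul_rpow_neg _ hq0
    have hrc : r * c = 1 := CFC.rpow_neg_mul_rpow _ hq0
    have hrs : star r = r := (IsSelfAdjoint.of_nonneg CFC.rpow_nonneg).star_eq
    have hcs : star c = c := (IsSelfAdjoint.of_nonneg CFC.rpow_nonneg).star_eq
    have hrqr : r * q * r = 1 := CFC.conjugate_rpow_neg_one_half q hq0
    have hcc : c * c = q := by
      calc c * c = c * (r * q * r) * c := by rw [hrqr, mul_one]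
        _ = (c * r) * q * (r * c) := by simp only [mul_assoc]
        _ = q := by rw [hcr, hrc, one_mul, mul_one]
    have hgq : r * g * star r ≤ 1 :=
      calc r * g * star r ≤ r * q * star r :=
            star_right_conjugate_le_conjugate
              (le_add_of_nonneg_right (algebraMap_nonneg A hε.le)) r
        _ = 1 := by rw [hrs, hrqr]
    have hg1 : ‖r * g * star r‖ ≤ 1 :=
      (CStarAlgebra.norm_le_one_iff_of_nonneg _ (star_right_conjugate_nonneg hg r)).mpr hgq
    have hpn : ‖r * p * star r‖ ≤ L :=
      (h r).trans (mul_le_of_le_one_right hL hg1)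
    have hps : IsSelfAdjoint (r * p * star r) := hp.conjugate r
    have hle : r * p * star r ≤ algebraMap ℝ A L :=
      hps.le_algebraMap_norm_self.trans (algebraMap_mono A hpn)
    have := star_right_conjugate_le_conjugate hle c
    calc p = c * (r * p * star r) * star c := by
          rw [hrs, hcs]
          calc p = (c * r) * p * (r * c) := by rw [hcr, hrc, one_mul, mul_one]
            _ = _ := by simp only [mul_assoc]
      _ ≤ c * algebraMap ℝ A L * star c := this
      _ = L • q := by
          rw [hcs, Algebra.algebraMap_eq_smul_one, mul_smul_comm, mul_one, smul_mul_assoc, hcc]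
  have hlim : Filter.Tendsto (fun ε : ℝ => L • (g + algebraMap ℝ A ε))
      (nhdsWithin 0 (Set.Ioi 0)) (nhds (L • (g + algebraMap ℝ A 0))) :=
    (Continuous.tendsto (by fun_prop) _).mono_left nhdsWithin_le_nhds
  rw [map_zero, add_zero] at hlim
  exact ge_of_tendsto hlim (Filter.eventually_of_mem self_mem_nhdsWithin fun ε hε' => hε ε hε')

end Order

/-! ### Closed graph theorem for families of operators integrated pointwise. -/

section Banach

variable {Ω E G : Type*} [MeasurableSpace Ω] {μ : Measure Ω} [NormedAddCommGroup E]
  [NormedSpace ℂ E] [CompleteSpace E] [NormedAddCommGroup G] [NormedSpace ℂ G] [CompleteSpace G]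

/-- The integral of a pointwise integrable family of bounded operators is a bounded operator. -/
theorem exists_clm_eq_integral {F : Ω → E →L[ℂ] G} (hF : ∀ x, Integrable (fun ω => F ω x) μ) :
    ∃ T : E →L[ℂ] G, ∀ x, T x = ∫ ω, F ω x ∂μ := by
  let Φ : E →ₗ[ℂ] Ω →₁[μ] G :=
    { toFun := fun x => (hF x).toL1 _
      map_add' := fun x y => by
        rw [← Integrable.toL1_add]
        congr 1
        ext ω
        simp
      map_smul' := fun c x => by
        rw [RingHom.id_apply, ← Integrable.toL1_smul]
        congr 1
        ext ω
        simp }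
  -- Closed graph: an `L¹`-convergent sequence has an a.e. convergent subsequence, and continuity of
  -- each `F ω` identifies its limit. No measurability of `F` in operator norm is needed.
  have hΦ : Continuous Φ := by
    refine Φ.continuous_of_seq_closed_graph fun u x y hu hy => ?_
    obtain ⟨ns, hns, hae⟩ := (tendstoInMeasure_of_tendsto_Lp hy).exists_seq_tendsto_ae
    have hcoe : ∀ᵐ ω ∂μ, ∀ n, Φ (u n) ω = F ω (u n) :=
      ae_all_iff.mpr fun n => (hF (u n)).coeFn_toL1
    ext1
    filter_upwards [hae, hcoe, (hF x).coeFn_toL1] with ω h1 h2 h3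
    have h4 : Filter.Tendsto (fun i => F ω (u (ns i))) Filter.atTop (nhds (F ω x)) :=
      ((F ω).continuous.tendsto x).comp (hu.comp hns.tendsto_atTop)
    simp only [Function.comp_apply, h2] at h1
    exact (tendsto_nhds_unique h1 h4).trans h3.symm
  have hint : ∀ x, ∫ ω, Φ x ω ∂μ = ∫ ω, F ω x ∂μ := fun x =>
    integral_congr_ae (hF x).coeFn_toL1
  let T : E →ₗ[ℂ] G :=
    { toFun := fun x => ∫ ω, F ω x ∂μ
      map_add' := fun x y => by
        simp only [map_add]
        exact integral_add (hF x) (hF y)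
      map_smul' := fun c x => by
        simp only [map_smul]
        exact integral_smul c _ }
  exact ⟨⟨T, (continuous_integral.comp hΦ).congr hint⟩, fun _ => rfl⟩

end Banach

/-! ### The sesquilinear form of a Bessel mapping and its two-sided bound. -/

section Form

variable {A : Type*} [CStarAlgebra A] [PartialOrder A] [StarOrderedRing A]
  {M : Type*} [NormedAddCommGroup M] [NormedSpace ℂ M] [Module A M] [CStarModule A M]
  {Ω : Type*} [MeasurableSpace Ω] {μ : Measure Ω} {X Y : Ω → M}

/-- Polarization: the integrand is linear in `f` and conjugate linear in `g`, so it is a combination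
of four diagonal integrands. -/
theorem integrable_ip_mul_ip (h : ∀ f : M, Integrable (fun ω => ip A f (X ω) * ip A (Y ω) f) μ)
    (f g : M) : Integrable (fun ω => ip A f (X ω) * ip A (Y ω) g) μ := by
  have e : (fun ω => ip A f (X ω) * ip A (Y ω) g) = fun ω => (1 / 4 : ℂ) •
      ((ip A (f + g) (X ω) * ip A (Y ω) (f + g) - ip A (f - g) (X ω) * ip A (Y ω) (f - g)) +
        Complex.I • (ip A (f + Complex.I • g) (X ω) * ip A (Y ω) (f + Complex.I • g) -
          ip A (f - Complex.I • g) (X ω) * ip A (Y ω) (f - Complex.I • g))) := by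
    ext ω
    simp only [ip, CStarModule.inner_add_left, CStarModule.inner_add_right,
      CStarModule.inner_sub_left, CStarModule.inner_sub_right, CStarModule.inner_smul_left_complex,
      CStarModule.inner_smul_right_complex, mul_add, add_mul, mul_sub, sub_mul, smul_mul_assoc,
      mul_smul_comm, Complex.star_def, Complex.conj_I]
    match_scalars <;> ring_nf <;> simp
    norm_num
  rw [e]
  exact (((h _).sub (h _)).add (((h _).sub (h _)).smul Complex.I)).smul (1 / 4 : ℂ)

theorem exists_clm_eq_integral_ip [CompleteSpace M] (g : M)
    (h : ∀ f, Integrable (fun ω => ip A f (X ω) * ip A (Y ω) g) μ) :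
    ∃ T : M →L[ℂ] A, ∀ f, T f = ∫ ω, ip A f (X ω) * ip A (Y ω) g ∂μ :=
  exists_clm_eq_integral (F := fun ω =>
    ((ContinuousLinearMap.mul ℂ A).flip (ip A (Y ω) g)).comp (CStarModule.innerSL (X ω))) h

/-- The form is separately continuous by the closed graph theorem, and a separately continuous
sesquilinear form on a Banach space is bounded. -/
theorem exists_norm_integral_ip_le [CompleteSpace M]
    (h : ∀ f : M, Integrable (fun ω => ip A f (X ω) * ip A (Y ω) f) μ) :
    ∃ L : ℝ, 0 ≤ L ∧ ∀ f : M, ‖∫ ω, ip A f (X ω) * ip A (Y ω) f ∂μ‖ ≤ L * ‖f‖ ^ 2 := by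
  have h2 := integrable_ip_mul_ip h
  -- The form is conjugate linear in `g`. Its adjoint is linear in `g`, so the closed graph lemma
  -- applies in that variable as well.
  have hstar : ∀ f g : M, (fun ω => ip A g (Y ω) * ip A (X ω) f) =
      fun ω => star (ip A f (X ω) * ip A (Y ω) g) := by
    intro f g
    ext ω
    simp only [ip, star_mul, CStarModule.star_inner]
  have h2' : ∀ f g : M, Integrable (fun ω => ip A g (Y ω) * ip A (X ω) f) μ := by
    intro f g
    rw [hstar]
    exact (starL' ℝ (A := A)).toContinuousLinearMap.integrable_comp (h2 f g)
  choose T hT using fun g : M => exists_clm_eq_integral_ip g fun f => h2 f g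
  choose T' hT' using fun f : M => exists_clm_eq_integral_ip f (h2' f)
  have hTT' : ∀ f g, ‖T g f‖ = ‖T' f g‖ := by
    intro f g
    rw [hT, hT', hstar, ← norm_star]
    congr 1
    exact ((starL' ℝ (A := A)).toContinuousLinearMap.integral_comp_comm (h2 f g)).symm
  -- The family `T g` with `‖g‖ ≤ 1` is pointwise bounded: at `f` the bound is `‖T' f‖`.
  obtain ⟨L, hL⟩ := banach_steinhaus (g := fun g : {g : M // ‖g‖ ≤ 1} => T g) fun f =>
    ⟨‖T' f‖, fun g => (hTT' f g).trans_le <|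
      ((T' f).le_opNorm g).trans (mul_le_of_le_one_right (norm_nonneg _) g.2)⟩
  have hL0 : 0 ≤ L := (norm_nonneg _).trans (hL ⟨0, by simp⟩)
  refine ⟨L, hL0, fun f => ?_⟩
  rw [← hT]
  by_cases hf : ‖f‖ = 0
  · rw [norm_eq_zero.mp hf]
    simp
  set g : M := ((‖f‖⁻¹ : ℝ) : ℂ) • f with hg
  have hg1 : ‖g‖ ≤ 1 := by
    rw [hg, norm_smul, Complex.norm_real, norm_inv, norm_norm, inv_mul_cancel₀ hf]
  have hfg : f = ((‖f‖ : ℝ) : ℂ) • g := by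
    rw [hg, smul_smul, ← Complex.ofReal_mul, mul_inv_cancel₀ hf, Complex.ofReal_one, one_smul]
  -- The scalar `‖f‖` is pulled out of the index of `T` by passing to `T'`, where that index becomes
  -- a linear argument.
  have e : ‖T f f‖ = ‖f‖ * ‖T g f‖ := by
    rw [hTT', hTT']
    conv_lhs => rw [show T' f f = T' f (((‖f‖ : ℝ) : ℂ) • g) by rw [← hfg]]
    rw [map_smul, norm_smul, Complex.norm_real, norm_norm]
  rw [e]
  calc ‖f‖ * ‖T g f‖ ≤ ‖f‖ * (L * ‖f‖) := by
        gcongr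
        exact ((T g).le_opNorm f).trans (by gcongr; exact hL ⟨g, hg1⟩)
    _ = L * ‖f‖ ^ 2 := by ring

/-- A Bessel mapping on a complete module is bounded from both sides. -/
theorem IsBesselOn.exists_two_sided_bound [CompleteSpace M]
    (h : IsBesselOn A Set.univ μ X Y) : ∃ L : ℝ, 0 ≤ L ∧ ∀ f : M,
      ∫ ω, ip A f (X ω) * ip A (Y ω) f ∂μ ≤ L • ip A f f ∧
        -(∫ ω, ip A f (X ω) * ip A (Y ω) f ∂μ) ≤ L • ip A f f := by
  have hi : ∀ f : M, Integrable (fun ω => ip A f (X ω) * ip A (Y ω) f) μ :=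
    fun f => h.integrable f trivial
  obtain ⟨L, hL0, hL⟩ := exists_norm_integral_ip_le hi
  obtain ⟨K, -, hK⟩ := h.bound
  refine ⟨L, hL0, fun f => ?_⟩
  set p := ∫ ω, ip A f (X ω) * ip A (Y ω) f ∂μ with hp
  -- The given constant `K` serves only here: the inequality `p ≤ K ⟨f, f⟩` makes the difference
  -- positive, hence `p` selfadjoint.
  have hsa : IsSelfAdjoint p := by
    have h1 : IsSelfAdjoint (K • ip A f f - p) :=
      IsSelfAdjoint.of_nonneg (sub_nonneg.mpr (hK f trivial))
    have h2 : IsSelfAdjoint (K • ip A f f) :=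
      (IsSelfAdjoint.all K).smul CStarModule.isSelfAdjoint_inner_self
    simpa using h2.sub h1
  have hconj : ∀ a : A, ‖a * p * star a‖ ≤ L * ‖a * ip A f f * star a‖ := by
    intro a
    -- A compression of the form at `f` is the form at `a • f`, so the norm bound for all vectors
    -- covers all compressions.
    have e1 : a * p * star a = ∫ ω, ip A (a • f) (X ω) * ip A (Y ω) (a • f) ∂μ := by
      rw [hp, ← integral_const_mul_of_integrable (hi f),
        ← integral_mul_const_of_integrable ((hi f).const_mul a)]
      simp only [ip, CStarModule.inner_op_smul_right, CStarModule.inner_op_smul_left, mul_assoc]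
    have e2 : a * ip A f f * star a = ip A (a • f) (a • f) := by
      simp only [ip, CStarModule.inner_op_smul_right, CStarModule.inner_op_smul_left, mul_assoc]
    rw [e1, e2, ip, ← CStarModule.norm_sq_eq]
    exact hL _
  have hnn : 0 ≤ ip A f f := CStarModule.inner_self_nonneg
  refine ⟨le_smul_of_norm_conjugate_le hsa hnn hL0 hconj,
    le_smul_of_norm_conjugate_le hsa.neg hnn hL0 fun a => ?_⟩
  rw [mul_neg, neg_mul, norm_neg]
  exact hconj a

end Form

end BesselTensor

namespace BesselTensor

set_option linter.unusedSectionVars false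

/-! ### Bounded module maps and their Gram matrices. -/

section ModuleMap

variable {A : Type*} [CStarAlgebra A] [PartialOrder A] [StarOrderedRing A]
  {M : Type*} [NormedAddCommGroup M] [NormedSpace ℂ M] [Module A M] [CStarModule A M]

/-- A bounded module map `T` satisfies `⟨T x, T x⟩ ≤ ‖T‖² ⟨x, x⟩`. -/
theorem inner_map_self_le {T : M →L[ℂ] M} (hT : ∀ (a : A) x, T (a • x) = a • T x) (x : M) :
    (inner A (T x) (T x) : A) ≤ ‖T‖ ^ 2 • inner A x x := by
  refine le_smul_of_norm_conjugate_le CStarModule.isSelfAdjoint_inner_self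
    CStarModule.inner_self_nonneg (by positivity) fun a => ?_
  have e : ∀ y : M, a * inner A y y * star a = inner A (a • y) (a • y) := fun y => by
    rw [CStarModule.inner_op_smul_right, CStarModule.inner_op_smul_left, mul_assoc]
  rw [e, e, ← hT, ← CStarModule.norm_sq_eq, ← CStarModule.norm_sq_eq, ← mul_pow]
  gcongr
  exact T.le_opNorm _

/-- The matrix `‖T‖² ⟨x k, x l⟩ - ⟨T (x k), T (x l)⟩` is of the form `star Y * Y`. -/
theorem exists_gram_sub_factor {T : M →L[ℂ] M} (hT : ∀ (a : A) x, T (a • x) = a • T x) {n : ℕ}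
    (x : Fin n → M) : ∃ Y : Fin n → Fin n → A, ∀ k l,
      ‖T‖ ^ 2 • (inner A (x k) (x l) : A) - inner A (T (x k)) (T (x l)) =
        ∑ r, star (Y r l) * Y r k := by
  obtain ⟨Y, hY⟩ := cstarMatrix_exists_factor
    (CStarMatrix.ofMatrix fun l k =>
      ‖T‖ ^ 2 • (inner A (x k) (x l) : A) - inner A (T (x k)) (T (x l))) (by
      ext k l
      change star (‖T‖ ^ 2 • (inner A (x k) (x l) : A) - inner A (T (x k)) (T (x l))) =
        ‖T‖ ^ 2 • (inner A (x l) (x k) : A) - inner A (T (x l)) (T (x k))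
      rw [star_sub, star_smul, CStarModule.star_inner, CStarModule.star_inner, star_trivial])
      (fun v => by
      -- Positivity of the matrix, tested on `v`, is the inequality for the single vector `∑ k, star
      -- (v k) • x k`, because `T` commutes with the coefficients.
      have h := sub_nonneg.mpr (inner_map_self_le hT (∑ k, star (v k) • x k))
      simp only [map_sum, hT, CStarModule.inner_sum_right, CStarModule.inner_sum_left,
        CStarModule.inner_op_smul_right, CStarModule.inner_op_smul_left, star_star,
        Finset.mul_sum, Finset.smul_sum, ← Finset.sum_sub_distrib] at h
      refine h.trans_eq (Finset.sum_congr rfl fun k _ => Finset.sum_congr rfl fun l _ => ?_)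
      change _ = star (v k) *
        (‖T‖ ^ 2 • (inner A (x l) (x k) : A) - inner A (T (x l)) (T (x k))) * v l
      simp only [mul_sub, sub_mul, mul_smul_comm, smul_mul_assoc,
        mul_assoc])
  refine ⟨fun r k => Y r k, fun k l => ?_⟩
  have := congrFun (congrFun hY l) k
  rw [CStarMatrix.mul_apply] at this
  exact this

/-- An adjoint with respect to the inner product is a module map. -/
theorem map_smul_of_adjoint {T T' : M →L[ℂ] M} (h : ∀ x y, ip A (T x) y = ip A x (T' y))
    (a : A) (y : M) : T' (a • y) = a • T' y := by
  have h' : ∀ x y, (inner A x (T' y) : A) = inner A (T x) y := fun x y => by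
    have := congrArg star (h x y)
    simpa only [ip, CStarModule.star_inner] using this.symm
  refine ext_inner (A := A) fun w => ?_
  rw [h', CStarModule.inner_op_smul_right, CStarModule.inner_op_smul_right, h']

end ModuleMap

/-! ### Weak multipliers and module linearity. -/

section Multiplier

variable {A : Type*} [CStarAlgebra A] [PartialOrder A] [StarOrderedRing A]
  {M : Type*} [NormedAddCommGroup M] [NormedSpace ℂ M] [Module A M] [CStarModule A M]
  {Ω : Type*} [MeasurableSpace Ω] {μ : Measure Ω} {m : Ω → ℂ} {X Y : Ω → M} {T : M →L[ℂ] M}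

/-- The bounded map `⟨·, g⟩` passes through the Bochner integral. Thus properties proved for weak
multipliers hold in both senses. -/
theorem IsMultiplierOn.isWeakMultiplierOn [CompleteSpace M] {S : Set M}
    (h : IsMultiplierOn A S μ m X Y T) : IsWeakMultiplierOn A S μ m X Y T := by
  intro f hf g _
  obtain ⟨hi, hT⟩ := h f hf
  have e : (fun ω => m ω • (ip A f (X ω) * ip A (Y ω) g)) =
      fun ω => CStarModule.innerSL (A := A) g (m ω • (ip A f (X ω) • Y ω)) := by
    ext ω
    rw [map_smul, CStarModule.innerSL_apply, CStarModule.inner_op_smul_right]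
    rfl
  rw [e]
  refine ⟨ContinuousLinearMap.integrable_comp _ hi, ?_⟩
  rw [ContinuousLinearMap.integral_comp_comm _ hi, ← hT]
  rfl

/-- The coefficient comes out of `⟨a • f, X⟩` on the left and then out of the integral. This
linearity is what makes `T₁ ⊗ T₂` bounded. -/
theorem IsWeakMultiplierOn.map_smul (h : IsWeakMultiplierOn A Set.univ μ m X Y T) (a : A) (f : M) :
    T (a • f) = a • T f := by
  refine ext_inner (A := A) fun g => ?_
  obtain ⟨hi, hT⟩ := h f trivial g trivial
  rw [CStarModule.inner_op_smul_right]
  refine (h (a • f) trivial g trivial).2.trans ?_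
  change _ = a * ip A (T f) g
  rw [hT, ← integral_const_mul_of_integrable hi]
  simp only [ip, CStarModule.inner_op_smul_right, mul_assoc, mul_smul_comm]

end Multiplier

/-! ### Positivity of elementary tensors in `C`. -/

section Tensor

variable {A B C : Type*} [CStarAlgebra A] [CStarAlgebra B] [CStarAlgebra C]
  (τ : CStarTensor A B C)

namespace CStarTensor

/-- The bounded bilinear map `(a, b) ↦ a ⊗ b`. -/
noncomputable def mulL : A →L[ℂ] B →L[ℂ] C :=
  LinearMap.mkContinuous₂
    ((LinearMap.mul ℂ C).compl₁₂ τ.left.toLinearMap τ.right.toLinearMap) 1 fun a b => by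
    rw [one_mul]
    exact (norm_mul_le _ _).trans (mul_le_mul (NonUnitalStarAlgHom.norm_apply_le τ.left a)
      (NonUnitalStarAlgHom.norm_apply_le τ.right b) (norm_nonneg _) (norm_nonneg _))

theorem mulL_apply (a : A) (b : B) : τ.mulL a b = τ.left a * τ.right b := rfl

variable [PartialOrder A] [StarOrderedRing A] [PartialOrder B] [StarOrderedRing B]
  [PartialOrder C] [StarOrderedRing C]

theorem left_nonneg {a : A} (ha : 0 ≤ a) : 0 ≤ τ.left a := by
  obtain ⟨b, rfl⟩ := CStarAlgebra.nonneg_iff_eq_star_mul_self.mp ha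
  rw [map_mul, map_star]
  exact star_mul_self_nonneg _

theorem right_nonneg {b : B} (hb : 0 ≤ b) : 0 ≤ τ.right b := by
  obtain ⟨b, rfl⟩ := CStarAlgebra.nonneg_iff_eq_star_mul_self.mp hb
  rw [map_mul, map_star]
  exact star_mul_self_nonneg _

/-- A product of commuting positive elements is positive. -/
theorem mulL_nonneg {a : A} {b : B} (ha : 0 ≤ a) (hb : 0 ≤ b) : 0 ≤ τ.mulL a b :=
  Commute.mul_nonneg (τ.left_nonneg ha) (τ.right_nonneg hb) (τ.commute a b)

/-- Two-sided bounds on the factors give a bound on an elementary tensor. -/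
theorem mulL_le {p a : A} {q b : B} (hp : p ≤ a) (hp' : -p ≤ a) (hq : q ≤ b) (hq' : -q ≤ b) :
    τ.mulL p q ≤ τ.mulL a b := by
  have h1 := τ.mulL_nonneg (sub_nonneg.mpr hp) (sub_nonneg.mpr hq')
  have h2 := τ.mulL_nonneg (sub_nonneg.mpr hp') (sub_nonneg.mpr hq)
  -- In `(a - p) ⊗ (b + q) + (a + p) ⊗ (b - q)` the mixed terms cancel, and both summands are
  -- positive.
  have e : τ.mulL (a - p) (b - -q) + τ.mulL (a - -p) (b - q) =
      (2 : ℝ) • (τ.mulL a b - τ.mulL p q) := by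
    simp only [map_sub, map_neg, sub_apply, neg_apply,
      two_smul]
    abel
  have h3 := smul_nonneg (inv_nonneg.mpr (zero_le_two (α := ℝ))) ((add_nonneg h1 h2).trans_eq e)
  rw [smul_smul, inv_mul_cancel₀ two_ne_zero, one_smul] at h3
  exact sub_nonneg.mp h3

/-- The entrywise tensor product of two positive matrices has nonnegative sum. -/
theorem sum_mulL_nonneg {n : ℕ} {G : Fin n → Fin n → A} {H : Fin n → Fin n → B}
    (hG : ∃ Y : Fin n → Fin n → A, ∀ k l, G k l = ∑ r, star (Y r l) * Y r k)
    (hH : ∃ Z : Fin n → Fin n → B, ∀ k l, H k l = ∑ s, star (Z s l) * Z s k) :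
    0 ≤ ∑ k, ∑ l, τ.mulL (G k l) (H k l) := by
  obtain ⟨Y, hY⟩ := hG
  obtain ⟨Z, hZ⟩ := hH
  -- Schur product argument: the factorizations of `G` and `H` combine into a sum of squares `star w
  -- * w`, indexed by pairs `(r, s)`, with `w = ∑ k, Y r k ⊗ Z s k`.
  have key : ∑ k, ∑ l, τ.mulL (G k l) (H k l) =
      ∑ r, ∑ s, star (∑ k, τ.mulL (Y r k) (Z s k)) * ∑ k, τ.mulL (Y r k) (Z s k) := by
    have h1 : ∀ r s k l, star (τ.mulL (Y r l) (Z s l)) * τ.mulL (Y r k) (Z s k) =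
        τ.mulL (star (Y r l) * Y r k) (star (Z s l) * Z s k) := by
      intro r s k l
      simp only [mulL_apply, map_mul, star_mul, map_star]
      rw [(τ.commute _ _).star_star.eq.symm]
      simp only [mul_assoc]
      rw [← mul_assoc (star (τ.right (Z s l))), ← map_star τ.right, ← (τ.commute _ _).eq, mul_assoc]
    have h2 : ∀ k l, τ.mulL (G k l) (H k l) =
        ∑ r, ∑ s, τ.mulL (star (Y r l) * Y r k) (star (Z s l) * Z s k) := by
      intro k l
      simp only [hY, hZ, map_sum, sum_apply]
      exact Finset.sum_comm
    simp only [h2, star_sum, Finset.sum_mul_sum, h1]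
    rw [Finset.sum_comm]
    calc _ = ∑ l, ∑ r, ∑ k, ∑ s, τ.mulL (star (Y r l) * Y r k) (star (Z s l) * Z s k) :=
          Finset.sum_congr rfl fun l _ => Finset.sum_comm
      _ = ∑ r, ∑ l, ∑ k, ∑ s, τ.mulL (star (Y r l) * Y r k) (star (Z s l) * Z s k) :=
          Finset.sum_comm
      _ = ∑ r, ∑ l, ∑ s, ∑ k, τ.mulL (star (Y r l) * Y r k) (star (Z s l) * Z s k) :=
          Finset.sum_congr rfl fun r _ => Finset.sum_congr rfl fun l _ => Finset.sum_comm
      _ = _ := Finset.sum_congr rfl fun r _ => Finset.sum_comm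
  rw [key]
  exact Finset.sum_nonneg fun r _ => Finset.sum_nonneg fun s _ => star_mul_self_nonneg _

end CStarTensor

end Tensor

end BesselTensor

namespace BesselTensor

set_option linter.unusedSectionVars false

variable {A B C : Type*} [CStarAlgebra A] [CStarAlgebra B] [CStarAlgebra C]
  [PartialOrder A] [StarOrderedRing A] [PartialOrder B] [StarOrderedRing B]
  [PartialOrder C] [StarOrderedRing C] {τ : CStarTensor A B C}
  {M N : Type*} [NormedAddCommGroup M] [NormedSpace ℂ M] [Module A M] [CStarModule A M]
  [NormedAddCommGroup N] [NormedSpace ℂ N] [Module B N] [CStarModule B N]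

/-- The inner product of the Hilbert module structure takes precedence in instance search. -/
noncomputable local instance (priority := 2000) innerOfCStarModule : Inner C (ExtTensor τ M N) :=
  CStarModule.toInner

/-! ### Boundedness of `S ⊗ T` on the algebraic tensor product. -/

namespace PreTensor

variable (τ) in
/-- The map `x ⊗ y ↦ S x ⊗ T y` on the algebraic tensor product. -/
noncomputable def map (S : M →L[ℂ] M) (T : N →L[ℂ] N) :
    PreTensor τ M N →ₗ[ℂ] PreTensor τ M N :=
  TensorProduct.map S.toLinearMap T.toLinearMap

theorem map_tmul (S : M →L[ℂ] M) (T : N →L[ℂ] N) (x : M) (y : N) :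
    map τ S T (tmul τ x y) = tmul τ (S x) (T y) := rfl

/-- With Gram matrices `G`, `H` of the `x k`, `y k` and `G'`, `H'` of their images, the difference
telescopes entrywise: `‖S‖²‖T‖² G ⊗ H - G' ⊗ H' = ‖T‖² (‖S‖² G - G') ⊗ H + G' ⊗ (‖T‖² H - H')`. Both
terms are Schur products of positive matrices. -/
theorem form_map_self_le {S : M →L[ℂ] M} {T : N →L[ℂ] N} (hS : ∀ (a : A) x, S (a • x) = a • S x)
    (hT : ∀ (b : B) y, T (b • y) = b • T y) (z : PreTensor τ M N) :
    form τ M N (map τ S T z) (map τ S T z) ≤ (‖S‖ * ‖T‖) ^ 2 • form τ M N z z := by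
  obtain ⟨n, x, y, hz⟩ := TensorProduct.exists_sum_tmul_eq (R := ℂ) (M := M) (N := N) z
  have hz' : z = ∑ k, tmul τ (x k) (y k) := hz
  have e1 : form τ M N z z = ∑ k, ∑ l, τ.mulL (inner A (x k) (x l)) (inner B (y k) (y l)) := by
    rw [hz']
    simp only [map_sum, LinearMap.sum_apply, form_tmul]
    rw [Finset.sum_comm]
    rfl
  have e2 : form τ M N (map τ S T z) (map τ S T z) =
      ∑ k, ∑ l, τ.mulL (inner A (S (x k)) (S (x l))) (inner B (T (y k)) (T (y l))) := by
    rw [hz']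
    simp only [map_sum, LinearMap.sum_apply, map_tmul, form_tmul]
    rw [Finset.sum_comm]
    rfl
  have h1 := τ.sum_mulL_nonneg (exists_gram_sub_factor hS x) (exists_gram_factor (A := B) y)
  have h2 := τ.sum_mulL_nonneg (exists_gram_factor (A := A) fun k => S (x k))
    (exists_gram_sub_factor hT y)
  rw [← sub_nonneg]
  refine (add_nonneg (smul_nonneg (sq_nonneg ‖T‖) h1) h2).trans_eq ?_
  rw [e1, e2]
  simp only [Finset.smul_sum, ← Finset.sum_sub_distrib, ← Finset.sum_add_distrib]
  refine Finset.sum_congr rfl fun k _ => Finset.sum_congr rfl fun l _ => ?_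
  simp only [map_sub, sub_apply, ← Complex.coe_smul, map_smul, smul_apply, smul_sub, smul_smul]
  rw [mul_pow, Complex.ofReal_mul, mul_comm]
  abel

theorem norm_map_le {S : M →L[ℂ] M} {T : N →L[ℂ] N} (hS : ∀ (a : A) x, S (a • x) = a • S x)
    (hT : ∀ (b : B) y, T (b • y) = b • T y) (z : PreTensor τ M N) :
    ‖map τ S T z‖ ≤ ‖S‖ * ‖T‖ * ‖z‖ := by
  refine le_of_sq_le_sq ?_ (by positivity)
  rw [norm_sq, mul_pow, norm_sq]
  refine (CStarAlgebra.norm_le_norm_of_nonneg_of_le (form_self_nonneg _)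
    (form_map_self_le hS hT z)).trans_eq ?_
  rw [norm_smul, Real.norm_of_nonneg (by positivity)]

end PreTensor

/-! ### Operators and elementary tensors on the completion. -/

namespace ExtTensor

theorem inner_tmul_tmul (x x' : M) (y y' : N) :
    (inner C (tmul τ x y) (tmul τ x' y') : C) =
      τ.left (inner A x x') * τ.right (inner B y y') := inner_tmul _ _ _ _

theorem denseRange_ofPre : DenseRange (ofPre : PreTensor τ M N →L[ℂ] ExtTensor τ M N) :=
  UniformSpace.Completion.denseRange_coe

theorem norm_ofPre (z : PreTensor τ M N) : ‖(ofPre z : ExtTensor τ M N)‖ = ‖z‖ :=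
  UniformSpace.Completion.norm_coe z

/-- The definition of `ExtTensor.map` carries no proof of boundedness. The norm bound for module
maps is supplied here and identifies the extension on the dense image of the algebraic tensor
product. -/
theorem map_tmul {S : M →L[ℂ] M} {T : N →L[ℂ] N} (hS : ∀ (a : A) x, S (a • x) = a • S x)
    (hT : ∀ (b : B) y, T (b • y) = b • T y) (x : M) (y : N) :
    map S T (tmul τ x y) = tmul τ (S x) (T y) :=
  LinearMap.extendOfNorm_eq denseRange_ofPre ⟨‖S‖ * ‖T‖, fun z =>
    (norm_ofPre (PreTensor.map τ S T z)).trans_le <|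
      (PreTensor.norm_map_le hS hT z).trans_eq (congrArg _ (norm_ofPre z).symm)⟩
    (PreTensor.tmul τ x y)

/-- Pure tensors span a dense subspace; uniqueness of the multipliers rests on this. -/
theorem clm_ext {G : Type*} [NormedAddCommGroup G] [NormedSpace ℂ G]
    {S T : ExtTensor τ M N →L[ℂ] G} (h : ∀ x y, S (tmul τ x y) = T (tmul τ x y)) : S = T := by
  ext z
  refine denseRange_ofPre.induction_on z (isClosed_eq S.continuous T.continuous) fun v => ?_
  induction v using PreTensor.induction_on with
  | zero => simp only [map_zero]
  | tmul x y => exact h x y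
  | add v w hv hw => simp only [map_add, hv, hw]

theorem ext_inner_tmul {z w : ExtTensor τ M N}
    (h : ∀ x y, (inner C (tmul τ x y) z : C) = inner C (tmul τ x y) w) : z = w := by
  have h1 : CStarModule.innerSL (A := C) z = CStarModule.innerSL w :=
    clm_ext fun x y => by
      rw [CStarModule.innerSL_apply, CStarModule.innerSL_apply,
        ← CStarModule.star_inner (tmul τ x y) z, h, CStarModule.star_inner]
  refine BesselTensor.ext_inner (A := C) fun u => ?_
  rw [← CStarModule.star_inner z u, ← CStarModule.star_inner w u]
  exact congrArg star (DFunLike.congr_fun h1 u)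

/-- The adjoint is `S' ⊗ T'`, which is itself well behaved because adjoints are module maps. The
identity is extended from pure tensors by density, one variable at a time. -/
theorem isAdjointable_map {S : M →L[ℂ] M} {T : N →L[ℂ] N} (hS : ∀ (a : A) x, S (a • x) = a • S x)
    (hT : ∀ (b : B) y, T (b • y) = b • T y) (hS' : IsAdjointable A S) (hT' : IsAdjointable B T) :
    IsAdjointable C (map (τ := τ) S T) := by
  obtain ⟨S', hS'⟩ := hS'
  obtain ⟨T', hT'⟩ := hT'
  refine ⟨map S' T', fun z w => ?_⟩
  have h1 : ∀ x y w, (inner C (tmul τ (S x) (T y)) w : C) = inner C (tmul τ x y) (map S' T' w) := by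
    intro x y w
    have : CStarModule.innerSL (A := C) (tmul τ (S x) (T y)) =
        (CStarModule.innerSL (A := C) (tmul τ x y)).comp (map (τ := τ) S' T') := by
      refine clm_ext fun x' y' => ?_
      rw [ContinuousLinearMap.comp_apply, map_tmul (map_smul_of_adjoint hS')
        (map_smul_of_adjoint hT'), CStarModule.innerSL_apply, CStarModule.innerSL_apply,
        inner_tmul_tmul, inner_tmul_tmul]
      have e1 := congrArg star (hS' x x')
      have e2 := congrArg star (hT' y y')
      simp only [ip, CStarModule.star_inner] at e1 e2
      rw [e1, e2]
    exact DFunLike.congr_fun this w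
  have h2 : (CStarModule.innerSL (A := C) w).comp (map (τ := τ) S T) =
      CStarModule.innerSL (A := C) (map (τ := τ) S' T' w) := by
    refine clm_ext fun x y => ?_
    rw [ContinuousLinearMap.comp_apply, map_tmul hS hT, CStarModule.innerSL_apply,
      CStarModule.innerSL_apply, ← CStarModule.star_inner (tmul τ (S x) (T y)), h1,
      CStarModule.star_inner]
  exact DFunLike.congr_fun h2 z

theorem norm_tmul_le (x : M) (y : N) : ‖tmul τ x y‖ ≤ ‖x‖ * ‖y‖ := by
  refine le_of_sq_le_sq ?_ (by positivity)
  rw [CStarModule.norm_sq_eq C, inner_tmul_tmul, mul_pow, CStarModule.norm_sq_eq A (x := x),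
    CStarModule.norm_sq_eq B (x := y)]
  exact (norm_mul_le _ _).trans (mul_le_mul (NonUnitalStarAlgHom.norm_apply_le τ.left _)
    (NonUnitalStarAlgHom.norm_apply_le τ.right _) (norm_nonneg _) (norm_nonneg _))

variable (τ M N) in
/-- The bounded bilinear map `(x, y) ↦ x ⊗ y`. -/
noncomputable def tmulL : M →L[ℂ] N →L[ℂ] ExtTensor τ M N :=
  LinearMap.mkContinuous₂
    ((TensorProduct.mk ℂ M N).compr₂
      ((ofPre : PreTensor τ M N →L[ℂ] ExtTensor τ M N).toLinearMap :
        M ⊗[ℂ] N →ₗ[ℂ] ExtTensor τ M N)) 1 fun x y => by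
    rw [one_mul]
    exact norm_tmul_le x y

theorem tmulL_apply (x : M) (y : N) : tmulL τ M N x y = tmul τ x y := rfl

theorem smul_tmul_smul (a b : ℂ) (x : M) (y : N) :
    tmul τ (a • x) (b • y) = (a * b) • tmul τ x y := by
  simp only [← tmulL_apply, map_smul, smul_apply, smul_smul]
  rw [mul_comm]

theorem ip_tmul (x x' : M) (y y' : N) :
    ip C (tmul τ x y) (tmul τ x' y') = τ.mulL (ip A x x') (ip B y y') :=
  inner_tmul _ _ _ _

/-- The two inner factors commute, one lying in the range of `τ.right` and the other in that of
`τ.left`. This separates the variables of the integrands. -/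
theorem ip_mul_ip_tmul (f x y g : M) (f' x' y' g' : N) :
    ip C (tmul τ f f') (tmul τ x x') * ip C (tmul τ y y') (tmul τ g g') =
      τ.mulL (ip A f x * ip A y g) (ip B f' x' * ip B y' g') := by
  rw [ip_tmul, ip_tmul]
  simp only [CStarTensor.mulL_apply, map_mul]
  rw [mul_assoc, ← mul_assoc (τ.right (ip B f' x')), ← (τ.commute _ _).eq]
  simp only [mul_assoc]

end ExtTensor

/-! ### Fubini on the product space, and uniqueness. -/

section Product

variable {Ω₁ : Type*} [MeasurableSpace Ω₁] {μ₁ : Measure Ω₁} [SFinite μ₁]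
  {Ω₂ : Type*} [MeasurableSpace Ω₂] {μ₂ : Measure Ω₂} [SFinite μ₂]
  {X₁ Y₁ : Ω₁ → M} {X₂ Y₂ : Ω₂ → N} {m₁ : Ω₁ → ℂ} {m₂ : Ω₂ → ℂ}
  {T₁ : M →L[ℂ] M} {T₂ : N →L[ℂ] N}

theorem integrable_prod_bilin {E F G : Type*} [NormedAddCommGroup E] [NormedSpace ℂ E]
    [NormedAddCommGroup F] [NormedSpace ℂ F] [NormedAddCommGroup G] [NormedSpace ℂ G]
    (L : E →L[ℂ] F →L[ℂ] G) {f : Ω₁ → E} {g : Ω₂ → F} (hf : Integrable f μ₁)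
    (hg : Integrable g μ₂) :
    Integrable (fun z : Ω₁ × Ω₂ => L (f z.1) (g z.2)) (μ₁.prod μ₂) :=
  hf.op_fst_snd L.continuous₂ ⟨‖L‖, L.le_opNorm₂⟩ hg

theorem IsBesselOn.tmul [CompleteSpace M] [CompleteSpace N]
    (h₁ : IsBesselOn A Set.univ μ₁ X₁ Y₁) (h₂ : IsBesselOn B Set.univ μ₂ X₂ Y₂) :
    IsBesselOn C (pureTensors τ M N) (μ₁.prod μ₂)
      (fun ω => ExtTensor.tmul τ (X₁ ω.1) (X₂ ω.2))
      (fun ω => ExtTensor.tmul τ (Y₁ ω.1) (Y₂ ω.2)) where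
  stronglyMeasurable_left := by
    rintro _ ⟨x, y, rfl⟩
    simp only [ExtTensor.ip_tmul]
    exact τ.mulL.continuous₂.comp_stronglyMeasurable
      (((h₁.stronglyMeasurable_left x trivial).comp_measurable measurable_fst).prodMk
        ((h₂.stronglyMeasurable_left y trivial).comp_measurable measurable_snd))
  stronglyMeasurable_right := by
    rintro _ ⟨x, y, rfl⟩
    simp only [ExtTensor.ip_tmul]
    exact τ.mulL.continuous₂.comp_stronglyMeasurable
      (((h₁.stronglyMeasurable_right x trivial).comp_measurable measurable_fst).prodMk
        ((h₂.stronglyMeasurable_right y trivial).comp_measurable measurable_snd))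
  integrable := by
    rintro _ ⟨x, y, rfl⟩
    simp only [ExtTensor.ip_mul_ip_tmul]
    have hi := integrable_prod_bilin τ.mulL (h₁.integrable x trivial) (h₂.integrable y trivial)
    exact hi
  bound := by
    obtain ⟨K₁, hK₁, hb₁⟩ := h₁.exists_two_sided_bound
    obtain ⟨K₂, hK₂, hb₂⟩ := h₂.exists_two_sided_bound
    -- `K₁` and `K₂` come from the two-sided bounds and are only nonnegative; the summand `1` makes
    -- the constant strictly positive.
    refine ⟨K₁ * K₂ + 1, by positivity, ?_⟩
    rintro _ ⟨x, y, rfl⟩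
    simp only [ExtTensor.ip_mul_ip_tmul]
    rw [integral_prod_bilin τ.mulL (h₁.integrable x trivial) (h₂.integrable y trivial)]
    refine (τ.mulL_le (hb₁ x).1 (hb₁ x).2 (hb₂ y).1 (hb₂ y).2).trans ?_
    have hnn : 0 ≤ ip C (ExtTensor.tmul τ x y) (ExtTensor.tmul τ x y) :=
      CStarModule.inner_self_nonneg
    have e : τ.mulL (K₁ • ip A x x) (K₂ • ip B y y) =
        (K₁ * K₂) • ip C (ExtTensor.tmul τ x y) (ExtTensor.tmul τ x y) := by
      rw [ExtTensor.ip_tmul]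
      simp only [← Complex.coe_smul, map_smul, smul_apply, smul_smul]
      rw [Complex.ofReal_mul, mul_comm]
    rw [e]
    exact smul_le_smul_of_nonneg_right (by linarith) hnn

theorem IsMultiplierOn.tmul [CompleteSpace M] [CompleteSpace N]
    (h₁ : IsMultiplierOn A Set.univ μ₁ m₁ X₁ Y₁ T₁)
    (h₂ : IsMultiplierOn B Set.univ μ₂ m₂ X₂ Y₂ T₂) :
    IsMultiplierOn C (pureTensors τ M N) (μ₁.prod μ₂) (fun ω => m₁ ω.1 * m₂ ω.2)
      (fun ω => ExtTensor.tmul τ (X₁ ω.1) (X₂ ω.2))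
      (fun ω => ExtTensor.tmul τ (Y₁ ω.1) (Y₂ ω.2)) (ExtTensor.map T₁ T₂) := by
  rintro _ ⟨x, y, rfl⟩
  obtain ⟨hi₁, hT₁⟩ := h₁ x trivial
  obtain ⟨hi₂, hT₂⟩ := h₂ y trivial
  -- The vector-valued integrand is the tensor product of the two given integrands, since `(a ⊗ b) •
  -- (x ⊗ y) = a x ⊗ b y`; Fubini for `tmulL` then applies.
  have e : (fun ω : Ω₁ × Ω₂ => (m₁ ω.1 * m₂ ω.2) •
      (ip C (ExtTensor.tmul τ x y) (ExtTensor.tmul τ (X₁ ω.1) (X₂ ω.2)) •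
        ExtTensor.tmul τ (Y₁ ω.1) (Y₂ ω.2))) = fun ω => ExtTensor.tmulL τ M N
          (m₁ ω.1 • (ip A x (X₁ ω.1) • Y₁ ω.1)) (m₂ ω.2 • (ip B y (X₂ ω.2) • Y₂ ω.2)) := by
    ext ω
    rw [ExtTensor.tmulL_apply, ExtTensor.smul_tmul_smul, ExtTensor.ip_tmul,
      CStarTensor.mulL_apply, ExtTensor.smul_tmul]
  rw [e, integral_prod_bilin _ hi₁ hi₂, ← hT₁, ← hT₂]
  exact ⟨integrable_prod_bilin _ hi₁ hi₂, ExtTensor.map_tmul h₁.isWeakMultiplierOn.map_smul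
    h₂.isWeakMultiplierOn.map_smul x y⟩

theorem IsWeakMultiplierOn.tmul (h₁ : IsWeakMultiplierOn A Set.univ μ₁ m₁ X₁ Y₁ T₁)
    (h₂ : IsWeakMultiplierOn B Set.univ μ₂ m₂ X₂ Y₂ T₂) :
    IsWeakMultiplierOn C (pureTensors τ M N) (μ₁.prod μ₂) (fun ω => m₁ ω.1 * m₂ ω.2)
      (fun ω => ExtTensor.tmul τ (X₁ ω.1) (X₂ ω.2))
      (fun ω => ExtTensor.tmul τ (Y₁ ω.1) (Y₂ ω.2)) (ExtTensor.map T₁ T₂) := by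
  rintro _ ⟨x, y, rfl⟩ _ ⟨x', y', rfl⟩
  obtain ⟨hi₁, hT₁⟩ := h₁ x trivial x' trivial
  obtain ⟨hi₂, hT₂⟩ := h₂ y trivial y' trivial
  have e : (fun ω : Ω₁ × Ω₂ => (m₁ ω.1 * m₂ ω.2) •
      (ip C (ExtTensor.tmul τ x y) (ExtTensor.tmul τ (X₁ ω.1) (X₂ ω.2)) *
        ip C (ExtTensor.tmul τ (Y₁ ω.1) (Y₂ ω.2)) (ExtTensor.tmul τ x' y'))) = fun ω => τ.mulL
          (m₁ ω.1 • (ip A x (X₁ ω.1) * ip A (Y₁ ω.1) x'))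
          (m₂ ω.2 • (ip B y (X₂ ω.2) * ip B (Y₂ ω.2) y')) := by
    ext ω
    rw [ExtTensor.ip_mul_ip_tmul, _root_.map_smul, _root_.map_smul, smul_apply, smul_smul,
      mul_comm (m₂ ω.2)]
  have hi := integrable_prod_bilin τ.mulL hi₁ hi₂
  rw [e, integral_prod_bilin τ.mulL hi₁ hi₂, ← hT₁, ← hT₂,
    ExtTensor.map_tmul h₁.map_smul h₂.map_smul]
  exact ⟨hi, ExtTensor.ip_tmul _ _ _ _⟩

variable {Ω : Type*} [MeasurableSpace Ω] {μ : Measure Ω} {m : Ω → ℂ} {X Y : Ω → ExtTensor τ M N}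
  {S T : ExtTensor τ M N →L[ℂ] ExtTensor τ M N}

theorem IsMultiplierOn.unique (hS : IsMultiplierOn C (pureTensors τ M N) μ m X Y S)
    (hT : IsMultiplierOn C (pureTensors τ M N) μ m X Y T) : S = T :=
  ExtTensor.clm_ext fun x y => (hS _ ⟨x, y, rfl⟩).2.trans (hT _ ⟨x, y, rfl⟩).2.symm

/-- The weak identity is known only against pure tensors, so density is used twice: for the tested
vectors and for the arguments. -/
theorem IsWeakMultiplierOn.unique (hS : IsWeakMultiplierOn C (pureTensors τ M N) μ m X Y S)
    (hT : IsWeakMultiplierOn C (pureTensors τ M N) μ m X Y T) : S = T :=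
  ExtTensor.clm_ext fun x y => ExtTensor.ext_inner_tmul fun x' y' =>
    (hS _ ⟨x, y, rfl⟩ _ ⟨x', y', rfl⟩).2.trans (hT _ ⟨x, y, rfl⟩ _ ⟨x', y', rfl⟩).2.symm

end Product

end BesselTensor
theorem mainTheorem5 {A B C : Type*}
    [CStarAlgebra A] [PartialOrder A] [StarOrderedRing A]
    [CStarAlgebra B] [PartialOrder B] [StarOrderedRing B]
    [CStarAlgebra C] [PartialOrder C] [StarOrderedRing C] (τ : CStarTensor A B C)
    {M₁ : Type*} [NormedAddCommGroup M₁] [NormedSpace ℂ M₁] [CompleteSpace M₁]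
    [Module A M₁] [CStarModule A M₁]
    {M₂ : Type*} [NormedAddCommGroup M₂] [NormedSpace ℂ M₂] [CompleteSpace M₂]
    [Module B M₂] [CStarModule B M₂]
    {Ω₁ : Type*} [MeasurableSpace Ω₁] (μ₁ : Measure Ω₁) [SFinite μ₁]
    {Ω₂ : Type*} [MeasurableSpace Ω₂] (μ₂ : Measure Ω₂) [SFinite μ₂]
    (X₁ Y₁ : Ω₁ → M₁) (X₂ Y₂ : Ω₂ → M₂)
    (h₁ : IsBesselOn A Set.univ μ₁ X₁ Y₁) (h₂ : IsBesselOn B Set.univ μ₂ X₂ Y₂)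
    (m₁ : Ω₁ → ℂ) (hm₁ : Measurable m₁) (m₂ : Ω₂ → ℂ) (hm₂ : Measurable m₂)
    (X Y : Ω₁ × Ω₂ → ExtTensor τ M₁ M₂)
    (hX : ∀ ω, X ω = ExtTensor.tmul τ (X₁ ω.1) (X₂ ω.2))
    (hY : ∀ ω, Y ω = ExtTensor.tmul τ (Y₁ ω.1) (Y₂ ω.2))
    (m : Ω₁ × Ω₂ → ℂ) (hm : ∀ ω, m ω = m₁ ω.1 * m₂ ω.2) :
    IsBesselOn C (pureTensors τ M₁ M₂) (μ₁.prod μ₂) X Y ∧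
    (∀ (T₁ : M₁ →L[ℂ] M₁) (T₂ : M₂ →L[ℂ] M₂),
      (IsMultiplierOn A Set.univ μ₁ m₁ X₁ Y₁ T₁ ∧ IsMultiplierOn B Set.univ μ₂ m₂ X₂ Y₂ T₂ ∨
        IsWeakMultiplierOn A Set.univ μ₁ m₁ X₁ Y₁ T₁ ∧
          IsWeakMultiplierOn B Set.univ μ₂ m₂ X₂ Y₂ T₂) →
      (∀ f g, ExtTensor.map T₁ T₂ (ExtTensor.tmul τ f g) = ExtTensor.tmul τ (T₁ f) (T₂ g)) ∧
      (IsAdjointable A T₁ → IsAdjointable B T₂ →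
        IsAdjointable C (ExtTensor.map (τ := τ) T₁ T₂))) ∧
    (∀ (T₁ : M₁ →L[ℂ] M₁) (T₂ : M₂ →L[ℂ] M₂),
      IsMultiplierOn A Set.univ μ₁ m₁ X₁ Y₁ T₁ → IsMultiplierOn B Set.univ μ₂ m₂ X₂ Y₂ T₂ →
      ∀ T : ExtTensor τ M₁ M₂ →L[ℂ] ExtTensor τ M₁ M₂,
        IsMultiplierOn C (pureTensors τ M₁ M₂) (μ₁.prod μ₂) m X Y T ↔
          T = ExtTensor.map T₁ T₂) ∧
    (∀ (T₁ : M₁ →L[ℂ] M₁) (T₂ : M₂ →L[ℂ] M₂),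
      IsWeakMultiplierOn A Set.univ μ₁ m₁ X₁ Y₁ T₁ →
      IsWeakMultiplierOn B Set.univ μ₂ m₂ X₂ Y₂ T₂ →
      ∀ T : ExtTensor τ M₁ M₂ →L[ℂ] ExtTensor τ M₁ M₂,
        IsWeakMultiplierOn C (pureTensors τ M₁ M₂) (μ₁.prod μ₂) m X Y T ↔
          T = ExtTensor.map T₁ T₂) := by
  obtain rfl : X = _ := funext hX
  obtain rfl : Y = _ := funext hY
  obtain rfl : m = _ := funext hm
  -- In each equivalence the forward direction is uniqueness and the backward one is existence.
  refine ⟨h₁.tmul h₂, fun T₁ T₂ h => ?_, fun T₁ T₂ hT₁ hT₂ T =>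
      ⟨fun hT => hT.unique (hT₁.tmul hT₂), fun hT => hT ▸ hT₁.tmul hT₂⟩,
    fun T₁ T₂ hT₁ hT₂ T =>
      ⟨fun hT => hT.unique (hT₁.tmul hT₂), fun hT => hT ▸ hT₁.tmul hT₂⟩⟩
  obtain ⟨hT₁, hT₂⟩ : (∀ (a : A) x, T₁ (a • x) = a • T₁ x) ∧ ∀ (b : B) y, T₂ (b • y) = b • T₂ y := by
    rcases h with ⟨h, h'⟩ | ⟨h, h'⟩
    · exact ⟨h.isWeakMultiplierOn.map_smul, h'.isWeakMultiplierOn.map_smul⟩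
    · exact ⟨h.map_smul, h'.map_smul⟩
  exact ⟨ExtTensor.map_tmul hT₁ hT₂, ExtTensor.isAdjointable_map hT₁ hT₂⟩
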